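/- Let $P$ be a hyperbolic $n$-manifold with right-angled corners, i.e. a space locally isometric to $\{x_1\ge 0,\dots,x_n\ge 0\}\subset\mathbb H^n$ (hyperboloid model). It is stratified by codimension: a point has codimension $k$ if it lies on exactly $k$ of the walls $x_i=0$ in a chart. The faces of codimension $k$ are the closures of the connected components of the codimension-$k$ stratum; $\operatorname{Fac}(P)$ denotes the set of facets (codimension $1$). Assume that the facets are embedded: no facet is adjacent to itself along a ridge (codimension $2$). Let $V$ be a finite-dimensional vector space over $\mathbb Z_2$ and let $\lambda\colon\operatorname{Fac}(P)\to V$ be a proper coloring, meaning that the colors of the distinct facets passing through any common point are linearly independent. Let $M(P,\lambda)$ be the real toric manifold obtained from copies $P_v$ $(v\in V)$ of $P$ by gluing $P_v$ to $P_{v+\lambda(G)}$ along $G$ by the identity, for all $v\in V$ and $G\in\operatorname{Fac}(P)$; write $[v,x]$ for the image of the point $x$ of $P_v$. Let $F$ be a face of $P$, of dimension $m$. Let $\operatorname{supp}(F)$ be the set of facets of $P$ containing $F$, let $\operatorname{adj}(F)$ be the set of facets of $P$ that intersect the boundary of $F$ but not its interior, and let $M_F\subset M(P,\lambda)$ be the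 preimage of $F$ under the projection $M(P,\lambda)\to P$, $[v,x]\mapsto x$. Then: 1. $F$ is a hyperbolic $m$-manifold with right-angled corners and embedded facets. Each facet of $F$ is contained in exactly one element of $\operatorname{adj}(F)$, and the resulting natural map $\operatorname{Fac}(F)\to\operatorname{adj}(F)$ is surjective. 2. The composition $$\lambda_F\colon \operatorname{Fac}(F)\twoheadrightarrow\operatorname{adj}(F)\hookrightarrow\operatorname{Fac}(P)\xrightarrow{\ \lambda\ }V\twoheadrightarrow V/\langle\lambda(i)\mid i\in\operatorname{supp}(F)\rangle$$ is a proper coloring of $F$. 3. $M_F=M(F,\lambda_F)$: the rule $[\bar v,x]\mapsto[v,x]$ $(x\in F,\ v\in V)$ is a well-defined homeomorphism $M(F,\lambda_F)\to M_F$, and it is a local isometry for the gluing metric of $M(F,\lambda_F)$ and the restriction to $M_F$ of the gluing metric of $M(P,\lambda)$. -/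

import Mathlib

open Set Topology
open scoped ENNReal

namespace RightAngled

/-! ### The hyperbolic model -/

/-- Hyperbolic distance in `ℍⁿ`. Points of the upper sheet
`x₀² = 1 + x₁² + ⋯ + xₙ²`, `x₀ > 0` of the hyperboloid are given by their coordinates
`x₁, …, xₙ` (so `x₀ = √(1 + ∑ xᵢ²)`), and `cosh d(x, y) = x₀ y₀ - ∑ xᵢ yᵢ`. -/
noncomputable def hypDist {n : ℕ} (x y : Fin n → ℝ) : ℝ :=
  Real.arcosh (√(1 + ∑ i, x i ^ 2) * √(1 + ∑ i, y i ^ 2) - ∑ i, x i * y i)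

/-- The right-angled corner in `ℍⁿ`: the intersection of the `n` half-spaces `xᵢ ≥ 0`, whose
bounding hyperplanes `xᵢ = 0` are pairwise orthogonal. Every germ of a right-angled polytope
(at a point of any codimension) occurs at some point of it. -/
def corner (n : ℕ) : Set (Fin n → ℝ) := {y | ∀ i, 0 ≤ y i}

/-- A chart on a metric space `X`: an isometry from the open set `U` onto a relatively open
subset of the right-angled corner in `ℍⁿ`. -/
structure IsCornerChart {X : Type*} [MetricSpace X] (n : ℕ) (U : Set X)
    (φ : X → Fin n → ℝ) : Prop where
  isOpen : IsOpen U
  isometry : ∀ x ∈ U, ∀ y ∈ U, dist x y = hypDist (φ x) (φ y)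
  image : ∃ O : Set (Fin n → ℝ), IsOpen O ∧ φ '' U = O ∩ corner n

/-- `X` is a hyperbolic `n`-manifold with right-angled corners: it is locally isometric to the
right-angled corner in `ℍⁿ`. The metric of `X` matters only locally (it need not be a path
metric). Neither compactness nor connectedness is required. -/
def IsRightAngledManifold (n : ℕ) (X : Type*) [MetricSpace X] : Prop :=
  ∀ x : X, ∃ (U : Set X) (φ : X → Fin n → ℝ), IsCornerChart n U φ ∧ x ∈ U

/-! ### Strata, faces and facets -/

/-- The stratum of codimension `k`: points lying on exactly `k` of the walls `xᵢ = 0` in a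
chart. -/
def stratum {X : Type*} [MetricSpace X] (n k : ℕ) : Set X :=
  {x | ∃ (U : Set X) (φ : X → Fin n → ℝ), IsCornerChart n U φ ∧ x ∈ U ∧
    {i | φ x i = 0}.ncard = k}

/-- A face of codimension `k`: the closure of a connected component of the stratum of
codimension `k`. -/
def IsFace {X : Type*} [MetricSpace X] (n k : ℕ) (F : Set X) : Prop :=
  ∃ x ∈ (stratum n k : Set X), F = closure (connectedComponentIn (stratum n k) x)

/-- The set `Fac(X)` of facets (faces of codimension `1`) of an `n`-dimensional `X`. -/
def Facet (n : ℕ) (X : Type*) [MetricSpace X] : Type _ := {G : Set X // IsFace n 1 G}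

/-- Facets are embedded: no facet is adjacent to itself along a ridge, i.e. the two sheets of the
boundary meeting at a point of codimension `2` belong to two different facets. -/
def EmbeddedFacets (n : ℕ) (X : Type*) [MetricSpace X] : Prop :=
  ∀ x ∈ (stratum n 2 : Set X), ∃ G H : Facet n X, G ≠ H ∧ x ∈ G.1 ∧ x ∈ H.1

/-- The interior of an `n`-dimensional right-angled manifold (as a manifold with corners). -/
def interiorPoints (n : ℕ) (X : Type*) [MetricSpace X] : Set X := stratum n 0

/-- The boundary of an `n`-dimensional right-angled manifold (as a manifold with corners). -/
def boundaryPoints (n : ℕ) (X : Type*) [MetricSpace X] : Set X := (interiorPoints n X)ᶜ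

/-- `supp(F)`: the facets of `X` containing `F`. -/
def supp {X : Type*} [MetricSpace X] (n : ℕ) (F : Set X) : Set (Facet n X) :=
  {H | F ⊆ H.1}

/-- `adj(F)`: the facets of `X` that intersect the boundary of `F` but not its interior, where
`F` is a face of dimension `m` of the `n`-dimensional manifold `X`. -/
def adj {X : Type*} [MetricSpace X] (n m : ℕ) (F : Set X) : Set (Facet n X) :=
  {H | (∃ x ∈ boundaryPoints m F, (x : X) ∈ H.1) ∧ ∀ x ∈ interiorPoints m F, (x : X) ∉ H.1}

/-! ### Colorings and real toric manifolds -/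

/-- `lam` is a (proper) coloring: the colors of facets having a common point are linearly
independent. -/
def IsColoring {V : Type*} [AddCommGroup V] [Module (ZMod 2) V] (n : ℕ) (X : Type*)
    [MetricSpace X] (lam : Facet n X → V) : Prop :=
  ∀ x : X, LinearIndependent (ZMod 2) (fun G : {G : Facet n X // x ∈ G.1} => lam G.1)

/-- The elementary gluings between the copies `X_v = {v} × X`, `v ∈ V`: for each facet `G`, the
copies `X_v` and `X_{v + lam G}` are glued along `G` by the identity. -/
inductive Glue {V : Type*} [AddCommGroup V] (n : ℕ) (X : Type*) [MetricSpace X]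
    (lam : Facet n X → V) : (Σ _ : V, X) → (Σ _ : V, X) → Prop
  | glue (v : V) (G : Facet n X) (x : X) (hx : x ∈ G.1) : Glue n X lam ⟨v, x⟩ ⟨v + lam G, x⟩

/-- The space `M(X, lam)`: the disjoint union of copies of `X` indexed by `V`, modulo the
equivalence relation generated by the gluings. -/
def RealToric {V : Type*} [AddCommGroup V] (n : ℕ) (X : Type*) [MetricSpace X]
    (lam : Facet n X → V) : Type _ :=
  Quot (Glue n X lam)

namespace RealToric

/-- The quotient topology. -/
instance {V : Type*} [AddCommGroup V] (n : ℕ) (X : Type*) [MetricSpace X]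
    (lam : Facet n X → V) : TopologicalSpace (RealToric n X lam) :=
  inferInstanceAs (TopologicalSpace (Quot (Glue n X lam)))

variable {V : Type*} [AddCommGroup V] {n : ℕ} {X : Type*} [MetricSpace X] {lam : Facet n X → V}

/-- The point `x` of the copy `X_v`. -/
def mk (lam : Facet n X → V) (v : V) (x : X) : RealToric n X lam := Quot.mk _ ⟨v, x⟩

/-- The natural projection `M(X, lam) → X`. -/
def proj : RealToric n X lam → X :=
  Quot.lift (fun p => p.2) (by rintro _ _ ⟨v, G, x, hx⟩; rfl)

/-- `HasChain p q l`: one can go from `p` to `q` in finitely many steps, each of them inside one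
copy of `X`, the lengths of the steps adding up to `l`. -/
inductive HasChain (p : RealToric n X lam) : RealToric n X lam → ℝ≥0∞ → Prop
  | refl : HasChain p p 0
  | step (v : V) (x y : X) (l : ℝ≥0∞) :
      HasChain p (mk lam v x) l → HasChain p (mk lam v y) (l + edist x y)

/-- The quotient (gluing) distance on `M(X, lam)`: the infimum of the lengths of chains. It is
infinite between points that are not joined by a chain. Near each point it is the hyperbolic
distance obtained by gluing the hyperbolic metrics of the copies of `X`. -/
noncomputable def glueDist (p q : RealToric n X lam) : ℝ≥0∞ := sInf {l | HasChain p q l}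

end RealToric

/-- The induced coloring of a face `F` of `X`: the composition
`Fac(F) → adj(F) ↪ Fac(X) → V → V / ⟨lam i | i ∈ supp(F)⟩`, with first arrow `π` and third
arrow `lam`. -/
def inducedColoring {V : Type*} [AddCommGroup V] [Module (ZMod 2) V] {n m : ℕ} {X : Type*}
    [MetricSpace X] (F : Set X) (lam : Facet n X → V) (π : Facet m F → adj n m F) :
    Facet m F → V ⧸ Submodule.span (ZMod 2) (lam '' supp n F) :=
  fun G => (Submodule.span (ZMod 2) (lam '' supp n F)).mkQ (lam (π G).1)

end RightAngled

/-! All linear relations between points of the hyperboloid are determined by their Lorentz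
products, hence by their distances. A change of charts is therefore the restriction of a linear
map, which carries the cone over one chart onto the cone over the other, and so preserves the
number of coordinates that vanish at a point: the codimension does not depend on the chart.

In a small convex chart around `x` the strata are convex, so every wall through `x` lies in one
facet and, the facets being embedded, different walls lie in different facets. Thus the codimension
of a point is the number of facets through it, and near `x ∈ F` the face `F` consists of the points
that lie on all the facets in `supp F`, a coordinate subspace of the corner. The facets of `F`
through `x` correspond to the remaining facets of the ambient manifold through `x`; this gives the
map to `adj F`, and linear independence modulo the colors of `supp F`.

Two points `[v, x]` and `[w, x]` agree exactly when `v - w` is in the span of the colors of the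
facets through `x`. For `x ∈ F` these comprise the colors of `supp F`, which makes
`[v̄, x] ↦ [v, x]` well defined and injective. It does not increase gluing distances. Conversely,
the orthogonal projection of a chart onto `F` is `1`-Lipschitz and takes a point to one that lies on
all the facets through it, so it pushes short chains into `F` without making them longer. -/

namespace RightAngled

/-! ### The Lorentz product -/

section Lorentz

variable {ι : Type*} [Fintype ι] {n : ℕ}

/-- The time coordinate `x₀` of the point of the hyperboloid with space coordinates `x`. -/
noncomputable def timeCoord (x : ι → ℝ) : ℝ := √(1 + x ⬝ᵥ x)

/-- The Lorentz product `x₀ y₀ - ∑ xᵢ yᵢ` of two points of the hyperboloid, with the sign that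
makes it positive. -/
noncomputable def lorentz (x y : ι → ℝ) : ℝ := timeCoord x * timeCoord y - x ⬝ᵥ y

theorem dotProduct_self_nonneg (x : ι → ℝ) : 0 ≤ x ⬝ᵥ x :=
  Finset.sum_nonneg fun i _ => mul_self_nonneg (x i)

theorem dotProduct_sq_le (x y : ι → ℝ) : (x ⬝ᵥ y) ^ 2 ≤ (x ⬝ᵥ x) * (y ⬝ᵥ y) := by
  simpa only [dotProduct, sq] using Finset.sum_mul_sq_le_sq_mul_sq Finset.univ x y

theorem hypDist_eq_arcosh (x y : Fin n → ℝ) : hypDist x y = Real.arcosh (lorentz x y) := by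
  simp only [hypDist, lorentz, timeCoord, dotProduct, sq]

theorem timeCoord_sq (x : ι → ℝ) : timeCoord x ^ 2 = 1 + x ⬝ᵥ x :=
  Real.sq_sqrt (by linarith [dotProduct_self_nonneg x])

theorem one_le_timeCoord (x : ι → ℝ) : 1 ≤ timeCoord x :=
  Real.one_le_sqrt.2 (by linarith [dotProduct_self_nonneg x])

theorem timeCoord_pos (x : ι → ℝ) : 0 < timeCoord x := zero_lt_one.trans_le (one_le_timeCoord x)

theorem timeCoord_eq_of_sq {x : ι → ℝ} {t : ℝ} (ht : 0 ≤ t) (h : t ^ 2 = 1 + x ⬝ᵥ x) :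
    timeCoord x = t := by
  rw [timeCoord, ← h, Real.sqrt_sq ht]

theorem one_le_lorentz (x y : ι → ℝ) : 1 ≤ lorentz x y := by
  have hsub : 0 ≤ (x - y) ⬝ᵥ (x - y) := dotProduct_self_nonneg _
  rw [sub_dotProduct, dotProduct_sub, dotProduct_sub, dotProduct_comm y x] at hsub
  have hle : 1 + x ⬝ᵥ y ≤ timeCoord x * timeCoord y := by
    refine le_of_abs_le (abs_le_of_sq_le_sq ?_ (mul_pos (timeCoord_pos x) (timeCoord_pos y)).le)
    rw [mul_pow, timeCoord_sq, timeCoord_sq]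
    nlinarith [dotProduct_sq_le x y]
  rw [lorentz]
  linarith

theorem lorentz_self (x : ι → ℝ) : lorentz x x = 1 := by
  rw [lorentz, ← sq, timeCoord_sq, add_sub_cancel_right]

theorem hypDist_self (x : Fin n → ℝ) : hypDist x x = 0 := by
  rw [hypDist_eq_arcosh, lorentz_self, Real.arcosh_zero]

theorem cosh_hypDist (x y : Fin n → ℝ) : Real.cosh (hypDist x y) = lorentz x y := by
  rw [hypDist_eq_arcosh, Real.cosh_arcosh (one_le_lorentz x y)]

theorem hypDist_le_iff {m : ℕ} {x y : Fin n → ℝ} {z w : Fin m → ℝ} :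
    hypDist x y ≤ hypDist z w ↔ lorentz x y ≤ lorentz z w := by
  rw [hypDist_eq_arcosh, hypDist_eq_arcosh, Real.arcosh_le_arcosh
    (zero_lt_one.trans_le (one_le_lorentz _ _)) (zero_lt_one.trans_le (one_le_lorentz _ _))]

theorem continuous_timeCoord : Continuous (timeCoord : (ι → ℝ) → ℝ) := by
  unfold timeCoord dotProduct
  fun_prop

theorem continuous_hypDist_left (x : Fin n → ℝ) : Continuous fun y => hypDist y x := by
  simp only [hypDist_eq_arcosh]
  refine Real.continuousOn_arcosh.comp_continuous (f := fun y => lorentz y x) ?_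
    fun y => one_le_lorentz y x
  have := continuous_timeCoord (ι := Fin n)
  unfold lorentz dotProduct
  fun_prop

theorem dotProduct_sub_lorentz_smul_self_le (x y : ι → ℝ) :
    (y - lorentz x y • x) ⬝ᵥ (y - lorentz x y • x) ≤ timeCoord x ^ 2 * (lorentz x y ^ 2 - 1) := by
  -- The vector `Y - ⟨x, y⟩ X` of `ℝ × ℝⁿ` is orthogonal to `X`, so its time coordinate is bounded
  -- by its space coordinates, which is Cauchy-Schwarz.
  have hcs := dotProduct_sq_le x (y - lorentz x y • x)
  have hxx : x ⬝ᵥ x = timeCoord x ^ 2 - 1 := by rw [timeCoord_sq]; ring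
  have hyy : y ⬝ᵥ y = timeCoord y ^ 2 - 1 := by rw [timeCoord_sq]; ring
  have hxy : x ⬝ᵥ y = timeCoord x * timeCoord y - lorentz x y := by rw [lorentz]; ring
  simp only [sub_dotProduct, dotProduct_sub, smul_dotProduct, dotProduct_smul, smul_eq_mul,
    dotProduct_comm y x, hxx, hyy, hxy] at hcs ⊢
  linarith

theorem dist_cosh_hypDist_smul_le (x y : Fin n → ℝ) :
    dist y (Real.cosh (hypDist x y) • x) ≤ timeCoord x * Real.sinh (hypDist x y) := by
  have hsinh : Real.sinh (hypDist x y) ^ 2 = lorentz x y ^ 2 - 1 := by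
    rw [Real.sinh_sq, cosh_hypDist]
  have hnonneg : 0 ≤ timeCoord x * Real.sinh (hypDist x y) :=
    mul_nonneg (timeCoord_pos x).le
      (Real.sinh_nonneg_iff.2 (hypDist_eq_arcosh x y ▸ Real.arcosh_nonneg (one_le_lorentz x y)))
  refine (dist_pi_le_iff hnonneg).2 fun i => abs_le_of_sq_le_sq ?_ hnonneg
  rw [cosh_hypDist, mul_pow, hsinh]
  refine le_trans ?_ (dotProduct_sub_lorentz_smul_self_le x y)
  rw [sq]
  exact Finset.single_le_sum (f := fun i => (y - lorentz x y • x) i * (y - lorentz x y • x) i)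
    (fun i _ => mul_self_nonneg _) (Finset.mem_univ i)

end Lorentz

/-! ### Charts -/

/-- The coordinates vanishing at `a`, that is, the walls of the corner through `a`. -/
def zeroSet {ι : Type*} (a : ι → ℝ) : Set ι := {i | a i = 0}

@[simp]
theorem mem_zeroSet {ι : Type*} {a : ι → ℝ} {i : ι} : i ∈ zeroSet a ↔ a i = 0 := Iff.rfl

theorem eventually_zeroSet_subset {n : ℕ} (a : Fin n → ℝ) :
    ∀ᶠ b in 𝓝 a, zeroSet b ⊆ zeroSet a := by
  simp only [subset_def, mem_zeroSet, Filter.eventually_all]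
  intro i
  by_cases hi : a i = 0
  · exact Filter.Eventually.of_forall fun _ _ => hi
  · filter_upwards [(continuous_apply i).continuousAt.eventually_ne hi] with b hb h0
    exact absurd h0 hb

theorem convex_corner (n : ℕ) : Convex ℝ (corner n) := fun _ hx _ hy _ _ hs ht _ i =>
  add_nonneg (mul_nonneg hs (hx i)) (mul_nonneg ht (hy i))

theorem convex_setOf_mem_corner_zeroSet_eq {n : ℕ} (S : Set (Fin n)) :
    Convex ℝ {a ∈ corner n | zeroSet a = S} := by
  rintro x ⟨hx, hxS⟩ y ⟨hy, hyS⟩ s t hs ht hst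
  refine ⟨convex_corner n hx hy hs ht hst, ext fun i => ?_⟩
  have hxi : x i = 0 ↔ i ∈ S := by rw [← hxS, mem_zeroSet]
  have hyi : y i = 0 ↔ i ∈ S := by rw [← hyS, mem_zeroSet]
  have hiff : s * x i + t * y i = 0 ↔ s * x i = 0 ∧ t * y i = 0 :=
    add_eq_zero_iff_of_nonneg (mul_nonneg hs (hx i)) (mul_nonneg ht (hy i))
  rw [mem_zeroSet, Pi.add_apply, Pi.smul_apply, Pi.smul_apply, smul_eq_mul, smul_eq_mul, hiff,
    mul_eq_zero, mul_eq_zero, hxi, hyi]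
  grind

theorem mem_closure_setOf_mem_corner_zeroSet_eq {n : ℕ} {a : Fin n → ℝ} (ha : a ∈ corner n)
    {S : Set (Fin n)} (hS : S ⊆ zeroSet a) : a ∈ closure {b ∈ corner n | zeroSet b = S} := by
  have hlim : Filter.Tendsto (fun t : ℝ => a + t • Sᶜ.indicator 1) (𝓝[>] 0) (𝓝 a) := by
    have hcont : Continuous fun t : ℝ => a + t • Sᶜ.indicator (1 : Fin n → ℝ) := by fun_prop
    simpa using (hcont.tendsto 0).mono_left nhdsWithin_le_nhds
  refine mem_closure_of_tendsto hlim (Filter.eventually_of_mem self_mem_nhdsWithin fun t ht => ?_)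
  suffices hcoord : ∀ i, 0 ≤ (a + t • Sᶜ.indicator (1 : Fin n → ℝ)) i ∧
      ((a + t • Sᶜ.indicator (1 : Fin n → ℝ)) i = 0 ↔ i ∈ S) from
    ⟨fun i => (hcoord i).1, ext fun i => (hcoord i).2⟩
  intro i
  by_cases hi : i ∈ S
  · simpa [hi] using ⟨(hS hi).ge, hS hi⟩
  · have hpos : 0 < a i + t := add_pos_of_nonneg_of_pos (ha i) ht
    simpa [hi] using ⟨hpos.le, hpos.ne'⟩

namespace IsCornerChart

variable {X : Type*} [MetricSpace X] {n : ℕ} {U V : Set X} {φ : X → Fin n → ℝ} {x y : X}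

theorem injOn (h : IsCornerChart n U φ) : InjOn φ U := fun x hx y hy hxy => by
  rw [← dist_eq_zero, h.isometry x hx y hy, hxy, hypDist_self]

theorem mem_corner (h : IsCornerChart n U φ) (hx : x ∈ U) : φ x ∈ corner n := by
  obtain ⟨O, -, hO⟩ := h.image
  exact (hO ▸ mem_image_of_mem φ hx : φ x ∈ O ∩ corner n).2

theorem cosh_dist (h : IsCornerChart n U φ) (hx : x ∈ U) (hy : y ∈ U) :
    Real.cosh (dist x y) = lorentz (φ x) (φ y) := by
  rw [h.isometry x hx y hy, cosh_hypDist]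

theorem continuousAt (h : IsCornerChart n U φ) (hx : x ∈ U) : ContinuousAt φ x := by
  have hcosh : Filter.Tendsto (fun y => Real.cosh (dist x y) • φ x) (𝓝 x) (𝓝 (φ x)) := by
    have hcont : Continuous fun y => Real.cosh (dist x y) • φ x := by fun_prop
    simpa using hcont.tendsto x
  have hsinh : Filter.Tendsto (fun y => timeCoord (φ x) * Real.sinh (dist x y)) (𝓝 x) (𝓝 0) := by
    have hcont : Continuous fun y => timeCoord (φ x) * Real.sinh (dist x y) := by fun_prop
    simpa using hcont.tendsto x
  refine hcosh.congr_dist (squeeze_zero' (Filter.Eventually.of_forall fun _ => dist_nonneg) ?_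
    hsinh)
  filter_upwards [h.isOpen.mem_nhds hx] with y hy
  rw [dist_comm, h.isometry x hx y hy]
  exact dist_cosh_hypDist_smul_le (φ x) (φ y)

theorem continuousOn (h : IsCornerChart n U φ) : ContinuousOn φ U :=
  fun _ hx => (h.continuousAt hx).continuousWithinAt

theorem image_mem_nhdsWithin (h : IsCornerChart n U φ) (hx : x ∈ U) (hV : V ∈ 𝓝 x) :
    φ '' (U ∩ V) ∈ 𝓝[corner n] φ x := by
  obtain ⟨O, hO, hUO⟩ := h.image
  have hxO : φ x ∈ O := (hUO ▸ mem_image_of_mem φ hx : φ x ∈ O ∩ corner n).1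
  obtain ⟨ε, hε, hball⟩ := Metric.mem_nhds_iff.1 hV
  have hd := (continuous_hypDist_left (φ x)).tendsto (φ x)
  rw [hypDist_self] at hd
  refine mem_nhdsWithin_iff_eventually.2 ?_
  filter_upwards [hO.mem_nhds hxO, hd.eventually_lt_const hε] with z hzO hz hzc
  obtain ⟨y, hy, rfl⟩ : z ∈ φ '' U := hUO ▸ ⟨hzO, hzc⟩
  exact ⟨y, ⟨hy, hball (by rwa [Metric.mem_ball, h.isometry y hy x hx])⟩, rfl⟩

theorem inter_isOpen (h : IsCornerChart n U φ) (hV : IsOpen V) : IsCornerChart n (U ∩ V) φ where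
  isOpen := h.isOpen.inter hV
  isometry x hx y hy := h.isometry x hx.1 y hy.1
  image := by
    refine ⟨interior {z | z ∈ corner n → z ∈ φ '' (U ∩ V)}, isOpen_interior, ?_⟩
    refine Subset.antisymm ?_ fun z hz => interior_subset hz.1 hz.2
    rintro _ ⟨y, hy, rfl⟩
    exact ⟨mem_interior_iff_mem_nhds.2 (mem_nhdsWithin_iff_eventually.1
      (h.image_mem_nhdsWithin hy.1 (hV.mem_nhds hy.2))), h.mem_corner hy.1⟩

theorem continuousOn_invFunOn [Nonempty X] (h : IsCornerChart n U φ) :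
    ContinuousOn (Function.invFunOn φ U) (φ '' U) := by
  rintro _ ⟨x, hx, rfl⟩
  rw [ContinuousWithinAt, h.injOn.leftInvOn_invFunOn hx]
  refine Filter.tendsto_def.2 fun W hW => ?_
  have hsub : φ '' U ⊆ corner n := image_subset_iff.2 fun y hy => h.mem_corner hy
  refine Filter.mem_of_superset (nhdsWithin_mono _ hsub (h.image_mem_nhdsWithin hx hW)) ?_
  rintro _ ⟨y, hy, rfl⟩
  rw [mem_preimage, h.injOn.leftInvOn_invFunOn hy.1]
  exact hy.2

theorem mem_closure_of_mem_closure (h : IsCornerChart n U φ) (hx : x ∈ U) {A : Set (Fin n → ℝ)}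
    (hA : A ⊆ corner n) (hxA : φ x ∈ closure A) : x ∈ closure {y ∈ U | φ y ∈ A} := by
  refine mem_closure_iff_nhds.2 fun V hV => ?_
  have := mem_closure_iff_nhdsWithin_neBot.1 hxA
  obtain ⟨_, ⟨y, hy, rfl⟩, hyA⟩ : (φ '' (U ∩ V) ∩ A).Nonempty := Filter.nonempty_of_mem
    (Filter.inter_mem (nhdsWithin_mono _ hA (h.image_mem_nhdsWithin hx hV)) self_mem_nhdsWithin)
  exact ⟨y, hy.2, hy.1, hyA⟩

theorem mem_closure_setOf_zeroSet_eq (h : IsCornerChart n U φ) (hx : x ∈ U) {S : Set (Fin n)}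
    (hS : S ⊆ zeroSet (φ x)) : x ∈ closure {y ∈ U | zeroSet (φ y) = S} :=
  closure_mono (fun _ hy => And.intro hy.1 hy.2.2) <|
    h.mem_closure_of_mem_closure hx (sep_subset _ _)
      (mem_closure_setOf_mem_corner_zeroSet_eq (h.mem_corner hx) hS)

theorem eventually_zeroSet_subset (h : IsCornerChart n U φ) (hx : x ∈ U) :
    ∀ᶠ y in 𝓝 x, zeroSet (φ y) ⊆ zeroSet (φ x) :=
  (h.continuousAt hx).eventually (RightAngled.eventually_zeroSet_subset (φ x))

end IsCornerChart

/-! ### The codimension of a point does not depend on the chart -/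

section Minkowski

variable {ι : Type*} [Fintype ι]

/-- The point of the hyperboloid in `ℝ × ℝⁿ` with space coordinates `x`. -/
noncomputable def hyperboloid (x : ι → ℝ) : ℝ × (ι → ℝ) := (timeCoord x, x)

/-- The Lorentz form `X₀ Y₀ - ∑ Xᵢ Yᵢ` on `ℝ × ℝⁿ`. -/
noncomputable def lorentzForm : ℝ × (ι → ℝ) →ₗ[ℝ] ℝ × (ι → ℝ) →ₗ[ℝ] ℝ :=
  (LinearMap.mul ℝ ℝ).compl₁₂ (LinearMap.fst ℝ ℝ _) (LinearMap.fst ℝ ℝ _) -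
    (dotProductBilin ℝ ℝ).compl₁₂ (LinearMap.snd ℝ ℝ _) (LinearMap.snd ℝ ℝ _)

theorem lorentzForm_apply (X Y : ℝ × (ι → ℝ)) : lorentzForm X Y = X.1 * Y.1 - X.2 ⬝ᵥ Y.2 := rfl

theorem lorentzForm_hyperboloid (x y : ι → ℝ) :
    lorentzForm (hyperboloid x) (hyperboloid y) = lorentz x y := rfl

theorem separatingLeft_lorentzForm : (lorentzForm (ι := ι)).SeparatingLeft := fun X hX => by
  have h := hX (X.1, -X.2)
  rw [lorentzForm_apply, dotProduct_neg, sub_neg_eq_add] at h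
  obtain ⟨h1, h2⟩ := (add_eq_zero_iff_of_nonneg (mul_self_nonneg X.1)
    (dotProduct_self_nonneg X.2)).1 h
  exact Prod.ext (mul_self_eq_zero.1 h1) (dotProduct_self_eq_zero.1 h2)

theorem smul_hyperboloid_inv_smul {x : ι → ℝ} {s t : ℝ} (hs : 0 < s) (ht : 0 < t)
    (h : t ^ 2 = s ^ 2 + x ⬝ᵥ x) : s • hyperboloid (s⁻¹ • x) = (t, x) := by
  have htime : timeCoord (s⁻¹ • x) = s⁻¹ * t := by
    refine timeCoord_eq_of_sq (by positivity) ?_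
    rw [mul_pow, h, smul_dotProduct, dotProduct_smul, smul_eq_mul, smul_eq_mul]
    field_simp
  rw [hyperboloid, htime, Prod.smul_mk, smul_inv_smul₀ hs.ne', smul_eq_mul,
    mul_inv_cancel_left₀ hs.ne']

/-- The space coordinates of the point of the hyperboloid on the ray through `Z`; junk unless `Z`
is timelike and future-directed. -/
noncomputable def radial (Z : ℝ × (ι → ℝ)) : ι → ℝ := (√(lorentzForm Z Z))⁻¹ • Z.2

theorem smul_hyperboloid_radial {Z : ℝ × (ι → ℝ)} (h0 : 0 < Z.1) (h : 0 < lorentzForm Z Z) :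
    √(lorentzForm Z Z) • hyperboloid (radial Z) = Z := by
  refine smul_hyperboloid_inv_smul (Real.sqrt_pos.2 h) h0 ?_
  rw [Real.sq_sqrt h.le, lorentzForm_apply, sq, sub_add_cancel]

theorem lorentzForm_hyperboloid_self (x : ι → ℝ) :
    lorentzForm (hyperboloid x) (hyperboloid x) = 1 := by
  rw [lorentzForm_hyperboloid, lorentz_self]

theorem radial_hyperboloid (x : ι → ℝ) : radial (hyperboloid x) = x := by
  rw [radial, lorentzForm_hyperboloid_self, Real.sqrt_one, inv_one, one_smul, hyperboloid]

theorem continuous_lorentzForm_self : Continuous fun Z : ℝ × (ι → ℝ) => lorentzForm Z Z := by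
  simp only [lorentzForm_apply, dotProduct]
  fun_prop

theorem continuousAt_radial (x : ι → ℝ) : ContinuousAt radial (hyperboloid x) := by
  refine ContinuousAt.smul (continuous_lorentzForm_self.sqrt.continuousAt.inv₀ ?_)
    continuous_snd.continuousAt
  rw [lorentzForm_hyperboloid_self, Real.sqrt_one]
  exact one_ne_zero

end Minkowski

section WallSubspace

variable {ι : Type*}

/-- The linear subspace of `ℝ × ℝⁿ` cut out by the walls `xᵢ = 0`, `i ∈ S`. -/
def wallSubspace (S : Set ι) : Submodule ℝ (ℝ × (ι → ℝ)) :=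
  LinearMap.ker (LinearMap.funLeft ℝ ℝ (Subtype.val : S → ι) ∘ₗ LinearMap.snd ℝ ℝ (ι → ℝ))

theorem mem_wallSubspace {S : Set ι} {Y : ℝ × (ι → ℝ)} :
    Y ∈ wallSubspace S ↔ ∀ i ∈ S, Y.2 i = 0 := by
  simp [wallSubspace, funext_iff, LinearMap.funLeft]

theorem ncard_add_finrank_wallSubspace [Finite ι] (S : Set ι) :
    S.ncard + Module.finrank ℝ (wallSubspace S) = Module.finrank ℝ (ℝ × (ι → ℝ)) := by
  classical
  have := Fintype.ofFinite S
  have hsurj : Function.Surjective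
      (LinearMap.funLeft ℝ ℝ (Subtype.val : S → ι) ∘ₗ LinearMap.snd ℝ ℝ (ι → ℝ)) :=
    (LinearMap.funLeft_surjective_of_injective ℝ ℝ _ Subtype.val_injective).comp
      (LinearMap.snd_surjective (R := ℝ) (M := ℝ))
  rw [wallSubspace, ← LinearMap.finrank_range_add_finrank_ker
    (LinearMap.funLeft ℝ ℝ (Subtype.val : S → ι) ∘ₗ LinearMap.snd ℝ ℝ (ι → ℝ)),
    LinearMap.range_eq_top.2 hsurj, finrank_top, Module.finrank_fintype_fun_eq_card,
    ← Nat.card_eq_fintype_card, Nat.card_coe_set_eq]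

end WallSubspace

/-- The cone over the image of a chart in the hyperboloid. -/
def chartCone {X : Type*} {n : ℕ} (U : Set X) (φ : X → Fin n → ℝ) : Set (ℝ × (Fin n → ℝ)) :=
  {Z | ∃ y ∈ U, ∃ s : ℝ, 0 < s ∧ s • hyperboloid (φ y) = Z}

namespace IsCornerChart

variable {X : Type*} [MetricSpace X] {n : ℕ} {U V : Set X} {φ ψ : X → Fin n → ℝ} {x : X}

theorem snd_mem_corner_of_mem_chartCone (h : IsCornerChart n U φ) {Z : ℝ × (Fin n → ℝ)}
    (hZ : Z ∈ chartCone U φ) : Z.2 ∈ corner n := by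
  obtain ⟨y, hy, s, hs, rfl⟩ := hZ
  exact fun i => mul_nonneg hs.le (h.mem_corner hy i)

theorem eventually_mem_chartCone (h : IsCornerChart n U φ) (hx : x ∈ U) :
    ∀ᶠ Z in 𝓝 (hyperboloid (φ x)), Z.2 ∈ corner n → Z ∈ chartCone U φ := by
  have hfuture : ∀ᶠ Z in 𝓝 (hyperboloid (φ x)), 0 < Z.1 :=
    (continuous_fst.tendsto _).eventually_const_lt (timeCoord_pos (φ x))
  have htimelike : ∀ᶠ Z in 𝓝 (hyperboloid (φ x)), 0 < lorentzForm Z Z := by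
    refine (continuous_lorentzForm_self.tendsto _).eventually_const_lt ?_
    rw [lorentzForm_hyperboloid_self]
    exact one_pos
  have himage : ∀ᶠ z in 𝓝 (radial (hyperboloid (φ x))), z ∈ corner n → z ∈ φ '' U := by
    rw [radial_hyperboloid, ← inter_univ U]
    exact mem_nhdsWithin_iff_eventually.1 (h.image_mem_nhdsWithin hx Filter.univ_mem)
  filter_upwards [hfuture, htimelike, (continuousAt_radial (φ x)).eventually himage]
    with Z h0 h1 hZ hZc
  obtain ⟨y, hy, hyZ⟩ := hZ fun i => mul_nonneg (inv_nonneg.2 (Real.sqrt_nonneg _)) (hZc i)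
  exact ⟨y, hy, _, Real.sqrt_pos.2 h1, hyZ ▸ smul_hyperboloid_radial h0 h1⟩

theorem eventually_snd_pos (h : IsCornerChart n U φ) (hx : x ∈ U) :
    ∀ᶠ Z in 𝓝 (hyperboloid (φ x)), ∀ i ∉ zeroSet (φ x), 0 < Z.2 i := by
  refine Filter.eventually_all.2 fun i => ?_
  by_cases hi : i ∈ zeroSet (φ x)
  · exact Filter.Eventually.of_forall fun _ h => absurd hi h
  · have hcont : Continuous fun Z : ℝ × (Fin n → ℝ) => Z.2 i := by fun_prop
    exact ((hcont.tendsto _).eventually_const_lt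
      ((h.mem_corner hx i).lt_of_ne' hi)).mono fun _ h _ => h

theorem span_image_hyperboloid_eq_top (h : IsCornerChart n U φ) (hx : x ∈ U) :
    Submodule.span ℝ ((fun y => hyperboloid (φ y)) '' U) = ⊤ := by
  obtain ⟨y, hy, hy0⟩ := closure_nonempty_iff.1
    ⟨x, h.mem_closure_setOf_zeroSet_eq hx (empty_subset _)⟩
  refine Submodule.eq_top_of_nonempty_interior' _
    ⟨hyperboloid (φ y), mem_interior_iff_mem_nhds.2 ?_⟩
  filter_upwards [h.eventually_mem_chartCone hy, h.eventually_snd_pos hy] with Z hZ hpos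
  obtain ⟨z, hz, s, -, rfl⟩ := hZ fun i => (hpos i (by simp [hy0])).le
  exact Submodule.smul_mem _ _ (Submodule.subset_span ⟨z, hz, rfl⟩)

theorem linearCombination_hyperboloid_eq_zero_iff (h : IsCornerChart n U φ) (hx : x ∈ U)
    (c : U →₀ ℝ) : Finsupp.linearCombination ℝ (fun y : U => hyperboloid (φ y)) c = 0 ↔
      ∀ z : U, Finsupp.linearCombination ℝ (fun y : U => Real.cosh (dist y z)) c = 0 := by
  have hpair (z : U) :
      lorentzForm (Finsupp.linearCombination ℝ (fun y : U => hyperboloid (φ y)) c)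
          (hyperboloid (φ z)) =
        Finsupp.linearCombination ℝ (fun y : U => Real.cosh (dist y z)) c := by
    simp only [Finsupp.linearCombination_apply, Finsupp.sum, map_sum, map_smul,
      LinearMap.sum_apply, LinearMap.smul_apply, lorentzForm_hyperboloid, Subtype.dist_eq,
      h.cosh_dist (Subtype.coe_prop _) z.2]
  simp only [← hpair]
  refine ⟨fun hc z => by rw [hc, map_zero, LinearMap.zero_apply], fun hc => ?_⟩
  refine separatingLeft_lorentzForm _ fun Y => ?_
  have hle : Submodule.span ℝ ((fun y => hyperboloid (φ y)) '' U) ≤ LinearMap.ker (lorentzForm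
      (Finsupp.linearCombination ℝ (fun y : U => hyperboloid (φ y)) c)) :=
    Submodule.span_le.2 (image_subset_iff.2 fun z hz => hc ⟨z, hz⟩)
  exact hle (h.span_image_hyperboloid_eq_top hx ▸ Submodule.mem_top)

theorem exists_linearEquiv (h : IsCornerChart n U φ) (h' : IsCornerChart n U ψ) (hx : x ∈ U) :
    ∃ A : (ℝ × (Fin n → ℝ)) ≃ₗ[ℝ] ℝ × (Fin n → ℝ),
      ∀ y ∈ U, A (hyperboloid (φ y)) = hyperboloid (ψ y) := by
  -- The linear relations between the points of the hyperboloid are determined by their distances.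
  have hker : LinearMap.ker (Finsupp.linearCombination ℝ fun y : U => hyperboloid (φ y)) =
      LinearMap.ker (Finsupp.linearCombination ℝ fun y : U => hyperboloid (ψ y)) := by
    ext c
    rw [LinearMap.mem_ker, LinearMap.mem_ker, h.linearCombination_hyperboloid_eq_zero_iff hx,
      h'.linearCombination_hyperboloid_eq_zero_iff hx]
  have hsurj {χ : X → Fin n → ℝ} (hχ : IsCornerChart n U χ) :
      Function.Surjective (Finsupp.linearCombination ℝ fun y : U => hyperboloid (χ y)) := by
    rw [← LinearMap.range_eq_top, Finsupp.range_linearCombination,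
      ← hχ.span_image_hyperboloid_eq_top hx, image_eq_range]
  refine ⟨((LinearMap.quotKerEquivOfSurjective _ (hsurj h)).symm.trans
    (Submodule.quotEquivOfEq _ _ hker)).trans (LinearMap.quotKerEquivOfSurjective _ (hsurj h')),
    fun y hy => ?_⟩
  have hsingle {χ : X → Fin n → ℝ} :
      Finsupp.linearCombination ℝ (fun y : U => hyperboloid (χ y)) (Finsupp.single ⟨y, hy⟩ 1) =
        hyperboloid (χ y) := by rw [Finsupp.linearCombination_single, one_smul]
  rw [LinearEquiv.trans_apply, LinearEquiv.trans_apply, ← hsingle,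
    LinearMap.quotKerEquivOfSurjective_symm_apply, Submodule.quotEquivOfEq_mk,
    LinearMap.quotKerEquivOfSurjective_apply_mk, hsingle]

theorem mem_wallSubspace_iff (h : IsCornerChart n U φ) (hx : x ∈ U) {Y : ℝ × (Fin n → ℝ)} :
    Y ∈ wallSubspace (zeroSet (φ x)) ↔
      ∀ᶠ t : ℝ in 𝓝 0, hyperboloid (φ x) + t • Y ∈ chartCone U φ := by
  rw [mem_wallSubspace]
  refine ⟨fun hY => ?_, fun hY i hi => ?_⟩
  · have hline : Filter.Tendsto (fun t : ℝ => hyperboloid (φ x) + t • Y) (𝓝 0)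
        (𝓝 (hyperboloid (φ x))) := by
      have hcont : Continuous fun t : ℝ => hyperboloid (φ x) + t • Y := by fun_prop
      simpa using hcont.tendsto 0
    filter_upwards [hline.eventually (h.eventually_mem_chartCone hx),
      hline.eventually (h.eventually_snd_pos hx)] with t hcone hpos
    refine hcone fun i => ?_
    by_cases hi : i ∈ zeroSet (φ x)
    · simp [hyperboloid, hY i hi, mem_zeroSet.1 hi]
    · exact (hpos i hi).le
  · have hneg : ∀ᶠ t : ℝ in 𝓝 0, hyperboloid (φ x) + (-t) • Y ∈ chartCone U φ :=
      (continuous_neg.tendsto' (0 : ℝ) 0 neg_zero).eventually hY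
    obtain ⟨t, ⟨h1, h2⟩, ht⟩ := (((hY.and hneg).filter_mono nhdsWithin_le_nhds).and
      (self_mem_nhdsWithin (s := Ioi (0 : ℝ)))).exists
    have h1 := h.snd_mem_corner_of_mem_chartCone h1 i
    have h2 := h.snd_mem_corner_of_mem_chartCone h2 i
    simp only [hyperboloid, Prod.snd_add, Prod.smul_snd, Pi.add_apply, Pi.smul_apply, smul_eq_mul,
      mem_zeroSet.1 hi] at h1 h2
    nlinarith [show 0 < t from ht]

theorem ncard_zeroSet_eq_of_same_domain (h : IsCornerChart n U φ) (h' : IsCornerChart n U ψ)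
    (hx : x ∈ U) : (zeroSet (φ x)).ncard = (zeroSet (ψ x)).ncard := by
  obtain ⟨A, hA⟩ := h.exists_linearEquiv h' hx
  have hcone (Z) : A Z ∈ chartCone U ψ ↔ Z ∈ chartCone U φ := by
    refine exists_congr fun y => and_congr_right fun hy => exists_congr fun s => ?_
    rw [← hA y hy, ← map_smul, A.injective.eq_iff]
  have hcomap : (wallSubspace (zeroSet (ψ x))).comap (A : _ →ₗ[ℝ] _) =
      wallSubspace (zeroSet (φ x)) := by
    ext Y
    rw [Submodule.mem_comap, h'.mem_wallSubspace_iff hx, h.mem_wallSubspace_iff hx, ← hA x hx]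
    simp only [LinearEquiv.coe_coe, ← map_smul, ← map_add, hcone]
  have hrank : Module.finrank ℝ (wallSubspace (zeroSet (ψ x))) =
      Module.finrank ℝ (wallSubspace (zeroSet (φ x))) := by
    rw [← A.finrank_map_eq (wallSubspace (zeroSet (φ x))), ← hcomap,
      Submodule.map_comap_eq_of_surjective A.surjective]
  have hφ := ncard_add_finrank_wallSubspace (zeroSet (φ x))
  have hψ := ncard_add_finrank_wallSubspace (zeroSet (ψ x))
  lia

theorem ncard_zeroSet_eq (h : IsCornerChart n U φ) (h' : IsCornerChart n V ψ) (hx : x ∈ U)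
    (hx' : x ∈ V) : (zeroSet (φ x)).ncard = (zeroSet (ψ x)).ncard :=
  (h.inter_isOpen h'.isOpen).ncard_zeroSet_eq_of_same_domain
    (inter_comm V U ▸ h'.inter_isOpen h.isOpen) ⟨hx, hx'⟩

theorem mem_stratum_iff (h : IsCornerChart n U φ) (hx : x ∈ U) {k : ℕ} :
    x ∈ (stratum n k : Set X) ↔ (zeroSet (φ x)).ncard = k :=
  ⟨fun ⟨_, _, h', hx', hk⟩ => (h.ncard_zeroSet_eq h' hx hx').trans hk,
    fun hk => ⟨U, φ, h, hx, hk⟩⟩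

end IsCornerChart

/-! ### Convex charts -/

/-- `(N, φ)` is a chart around `x` with convex image that meets only the walls through `x`. -/
structure IsConvexChart {X : Type*} [MetricSpace X] {n : ℕ} (N : Set X) (φ : X → Fin n → ℝ)
    (x : X) : Prop extends IsCornerChart n N φ where
  mem : x ∈ N
  convex_image : Convex ℝ (φ '' N)
  zeroSet_subset : ∀ y ∈ N, zeroSet (φ y) ⊆ zeroSet (φ x)

section ConvexChart

variable {X : Type*} [MetricSpace X] {n : ℕ} {U N W : Set X} {φ : X → Fin n → ℝ} {x : X}

theorem IsCornerChart.exists_isConvexChart (h : IsCornerChart n U φ) (hx : x ∈ U)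
    (hW : W ∈ 𝓝 x) : ∃ N, IsConvexChart N φ x ∧ N ⊆ U ∩ W := by
  have hW' : W ∩ {y | zeroSet (φ y) ⊆ zeroSet (φ x)} ∈ 𝓝 x :=
    Filter.inter_mem hW (h.eventually_zeroSet_subset hx)
  obtain ⟨ε, hε, hball⟩ := Metric.mem_nhdsWithin_iff.1 (h.image_mem_nhdsWithin hx hW')
  have hsub : U ∩ φ ⁻¹' Metric.ball (φ x) ε ⊆
      U ∩ (W ∩ {y | zeroSet (φ y) ⊆ zeroSet (φ x)}) := fun y hy => by
    obtain ⟨z, hz, hzy⟩ := hball ⟨hy.2, h.mem_corner hy.1⟩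
    rwa [← h.injOn hz.1 hy.1 hzy]
  have himage : φ '' (U ∩ φ ⁻¹' Metric.ball (φ x) ε) = Metric.ball (φ x) ε ∩ corner n := by
    refine Subset.antisymm ?_ fun z hz => ?_
    · rintro _ ⟨y, hy, rfl⟩
      exact ⟨hy.2, h.mem_corner hy.1⟩
    · obtain ⟨y, hy, rfl⟩ := hball hz
      exact ⟨y, ⟨hy.1, hz.1⟩, rfl⟩
  refine ⟨U ∩ φ ⁻¹' Metric.ball (φ x) ε, ⟨?_, ⟨hx, Metric.mem_ball_self hε⟩, ?_,
    fun y hy => (hsub hy).2.2⟩, fun y hy => ⟨hy.1, (hsub hy).2.1⟩⟩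
  · rw [← inter_eq_self_of_subset_right (inter_subset_left (s := U) (t := φ ⁻¹' _))]
    exact h.inter_isOpen (h.continuousOn.isOpen_inter_preimage h.isOpen Metric.isOpen_ball)
  · rw [himage]
    exact (convex_ball _ _).inter (convex_corner n)

theorem IsRightAngledManifold.exists_isConvexChart (hX : IsRightAngledManifold n X)
    (hW : W ∈ 𝓝 x) : ∃ (N : Set X) (φ : X → Fin n → ℝ), IsConvexChart N φ x ∧ N ⊆ W := by
  obtain ⟨U, φ, h, hx⟩ := hX x
  obtain ⟨N, hN, hNW⟩ := h.exists_isConvexChart hx hW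
  exact ⟨N, φ, hN, hNW.trans inter_subset_right⟩

theorem IsConvexChart.isPreconnected_setOf_zeroSet_eq (h : IsConvexChart N φ x)
    (S : Set (Fin n)) : IsPreconnected {y ∈ N | zeroSet (φ y) = S} := by
  have : Nonempty X := ⟨x⟩
  have hpre : IsPreconnected (φ '' N ∩ {a ∈ corner n | zeroSet a = S}) :=
    (h.convex_image.inter (convex_setOf_mem_corner_zeroSet_eq S)).isPreconnected
  convert hpre.image _ (h.continuousOn_invFunOn.mono inter_subset_left) using 1
  ext y
  constructor
  · rintro ⟨hy, hyS⟩
    exact ⟨φ y, ⟨mem_image_of_mem φ hy, h.mem_corner hy, hyS⟩, h.injOn.leftInvOn_invFunOn hy⟩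
  · rintro ⟨_, ⟨⟨w, hw, rfl⟩, -, hwS⟩, rfl⟩
    rw [h.injOn.leftInvOn_invFunOn hw]
    exact ⟨hw, hwS⟩

end ConvexChart

/-! ### Faces in a chart -/

section Faces

variable {X : Type*} [MetricSpace X] {n k : ℕ} {N F G W : Set X} {φ : X → Fin n → ℝ} {x y z : X}

theorem IsFace.isClosed (hF : IsFace n k F) : IsClosed F := by
  obtain ⟨x, -, rfl⟩ := hF
  exact isClosed_closure

theorem IsFace.exists_mem_stratum (hF : IsFace n k F) (hx : x ∈ F) (hW : W ∈ 𝓝 x) :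
    ∃ y ∈ W, y ∈ F ∧ y ∈ (stratum n k : Set X) := by
  obtain ⟨z, -, rfl⟩ := hF
  obtain ⟨y, hyW, hy⟩ := mem_closure_iff_nhds.1 hx W hW
  exact ⟨y, hyW, subset_closure hy, connectedComponentIn_subset _ _ hy⟩

theorem IsFace.exists_mem_and_mem_stratum (hF : IsFace n k F) :
    ∃ y ∈ F, y ∈ (stratum n k : Set X) := by
  obtain ⟨z, hz, rfl⟩ := hF
  exact ⟨z, subset_closure (mem_connectedComponentIn hz), hz⟩

theorem exists_isFace_of_mem_stratum (hx : x ∈ (stratum n k : Set X)) :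
    ∃ F, IsFace n k F ∧ x ∈ F :=
  ⟨_, ⟨x, hx, rfl⟩, subset_closure (mem_connectedComponentIn hx)⟩

namespace IsConvexChart

theorem setOf_zeroSet_eq_subset_stratum (h : IsConvexChart N φ x) {S : Set (Fin n)}
    (hS : S.ncard = k) : {z ∈ N | zeroSet (φ z) = S} ⊆ stratum n k :=
  fun _ hz => (h.mem_stratum_iff hz.1).2 (hz.2 ▸ hS)

theorem connectedComponentIn_eq (h : IsConvexChart N φ x) (hy : y ∈ N) (hz : z ∈ N)
    (hyz : zeroSet (φ y) = zeroSet (φ z)) (hk : (zeroSet (φ z)).ncard = k) :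
    connectedComponentIn (stratum n k : Set X) y = connectedComponentIn (stratum n k) z :=
  (_root_.connectedComponentIn_eq <|
    (h.isPreconnected_setOf_zeroSet_eq (zeroSet (φ z))).subset_connectedComponentIn ⟨hz, rfl⟩
      (h.setOf_zeroSet_eq_subset_stratum hk) ⟨hy, hyz⟩).symm

end IsConvexChart

variable (hX : IsRightAngledManifold n X)
include hX

theorem mem_connectedComponentIn_stratum_of_mem_closure
    (hy : y ∈ closure (connectedComponentIn (stratum n k : Set X) x))
    (hyk : y ∈ (stratum n k : Set X)) : y ∈ connectedComponentIn (stratum n k : Set X) x := by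
  obtain ⟨N, φ, h, -⟩ := hX.exists_isConvexChart (x := y) Filter.univ_mem
  obtain ⟨z, hzN, hz⟩ := mem_closure_iff_nhds.1 hy N (h.isOpen.mem_nhds h.mem)
  have hzk := (h.mem_stratum_iff hzN).1 (connectedComponentIn_subset _ _ hz)
  have hyk' := (h.mem_stratum_iff h.mem).1 hyk
  have hzy : zeroSet (φ z) = zeroSet (φ y) :=
    eq_of_subset_of_ncard_le (h.zeroSet_subset z hzN) (hyk'.trans hzk.symm).le (toFinite _)
  rw [connectedComponentIn_eq hz, h.connectedComponentIn_eq hzN h.mem hzy hyk']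
  exact mem_connectedComponentIn hyk

theorem IsFace.eq_closure (hF : IsFace n k F) (hy : y ∈ F) (hyk : y ∈ (stratum n k : Set X)) :
    F = closure (connectedComponentIn (stratum n k) y) := by
  obtain ⟨x, -, rfl⟩ := hF
  rw [connectedComponentIn_eq (mem_connectedComponentIn_stratum_of_mem_closure hX hy hyk)]

theorem IsFace.eq_of_mem_stratum (hF : IsFace n k F) (hG : IsFace n k G) (hyF : y ∈ F)
    (hyG : y ∈ G) (hyk : y ∈ (stratum n k : Set X)) : F = G := by
  rw [hF.eq_closure hX hyF hyk, hG.eq_closure hX hyG hyk]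

theorem IsFace.mem_of_zeroSet_subset (hF : IsFace n k F) (h : IsConvexChart N φ x) (hy : y ∈ N)
    (hyF : y ∈ F) (hyk : (zeroSet (φ y)).ncard = k) (hz : z ∈ N)
    (hyz : zeroSet (φ y) ⊆ zeroSet (φ z)) : z ∈ F := by
  rw [hF.eq_closure hX hyF ((h.mem_stratum_iff hy).2 hyk)]
  refine closure_mono ?_ (h.mem_closure_setOf_zeroSet_eq hz hyz)
  exact (h.isPreconnected_setOf_zeroSet_eq _).subset_connectedComponentIn ⟨hy, rfl⟩
    (h.setOf_zeroSet_eq_subset_stratum hyk)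

omit hX in
theorem IsFace.exists_zeroSet_subset (hF : IsFace n k F) (h : IsCornerChart n N φ) (hx : x ∈ N)
    (hxF : x ∈ F) : ∃ y ∈ N, y ∈ F ∧ zeroSet (φ y) ⊆ zeroSet (φ x) ∧ (zeroSet (φ y)).ncard = k := by
  obtain ⟨y, ⟨hy, hyx⟩, hyF, hyk⟩ := hF.exists_mem_stratum hxF
    (Filter.inter_mem (h.isOpen.mem_nhds hx) (h.eventually_zeroSet_subset hx))
  exact ⟨y, hy, hyF, hyx, (h.mem_stratum_iff hy).1 hyk⟩

/-- The facets of `X` through the point `x`. -/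
def facetsThrough {X : Type*} [MetricSpace X] (n : ℕ) (x : X) : Set (Facet n X) := {G | x ∈ G.1}

omit hX in
theorem mem_facetsThrough {G : Facet n X} : G ∈ facetsThrough n x ↔ x ∈ G.1 := Iff.rfl

theorem IsConvexChart.exists_facetsThrough_eq (h : IsConvexChart N φ x) :
    ∃ g : zeroSet (φ x) → Facet n X, ∀ y ∈ N, facetsThrough n y = g '' {i | φ y i = 0} := by
  have hwall (i : zeroSet (φ x)) : ∃ y ∈ N, zeroSet (φ y) = {i.1} :=
    closure_nonempty_iff.1 ⟨x, h.mem_closure_setOf_zeroSet_eq h.mem (singleton_subset_iff.2 i.2)⟩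
  choose p hpN hp using hwall
  have hp1 (i) : (zeroSet (φ (p i))).ncard = 1 := by rw [hp, ncard_singleton]
  choose g hg hpg using fun i =>
    exists_isFace_of_mem_stratum ((h.mem_stratum_iff (hpN i)).2 (hp1 i))
  have hmem {i y} (hy : y ∈ N) (hi : φ y i.1 = 0) : y ∈ g i :=
    (hg i).mem_of_zeroSet_subset hX h (hpN i) (hpg i) (hp1 i) hy
      (hp i ▸ singleton_subset_iff.2 hi)
  refine ⟨fun i => ⟨g i, hg i⟩, fun y hy => Subset.antisymm (fun G hyG => ?_) ?_⟩
  · obtain ⟨w, hw, hwG, hwy, hw1⟩ := G.2.exists_zeroSet_subset h.toIsCornerChart hy hyG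
    obtain ⟨i, hi⟩ := ncard_eq_one.1 hw1
    have hiw : i ∈ zeroSet (φ w) := hi ▸ mem_singleton i
    exact ⟨⟨i, h.zeroSet_subset w hw hiw⟩, hwy hiw, Subtype.ext <|
      (hg _).eq_of_mem_stratum hX G.2 (hmem hw hiw) hwG ((h.mem_stratum_iff hw).2 hw1)⟩
  · rintro _ ⟨i, hi, rfl⟩
    exact hmem hy hi

theorem eventually_facetsThrough_eq (hx : x ∈ (stratum n k : Set X)) :
    ∀ᶠ y in 𝓝 x, y ∈ (stratum n k : Set X) → facetsThrough n y = facetsThrough n x := by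
  obtain ⟨N, φ, h, -⟩ := hX.exists_isConvexChart (x := x) Filter.univ_mem
  obtain ⟨g, hg⟩ := h.exists_facetsThrough_eq hX
  filter_upwards [h.isOpen.mem_nhds h.mem] with y hy hyk
  have hzero : zeroSet (φ y) = zeroSet (φ x) :=
    eq_of_subset_of_ncard_le (h.zeroSet_subset y hy) (((h.mem_stratum_iff h.mem).1 hx).trans
      ((h.mem_stratum_iff hy).1 hyk).symm).le (toFinite _)
  have hiff (i) : φ y i = 0 ↔ φ x i = 0 := Set.ext_iff.1 hzero i
  simp only [hg y hy, hg x h.mem, hiff]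

theorem facetsThrough_eq_of_isPreconnected {C : Set X} (hC : IsPreconnected C)
    (hCk : C ⊆ stratum n k) (hx : x ∈ C) (hy : y ∈ C) :
    facetsThrough n x = facetsThrough n y := by
  refine hC.induction₂' (fun a b => facetsThrough n a = facetsThrough n b) (fun a ha => ?_)
    (fun _ _ _ _ _ _ => Eq.trans) hx hy
  filter_upwards [(eventually_facetsThrough_eq hX (hCk ha)).filter_mono nhdsWithin_le_nhds,
    self_mem_nhdsWithin] with b hb hbC
  exact ⟨(hb (hCk hbC)).symm, hb (hCk hbC)⟩

theorem IsFace.supp_eq_facetsThrough (hF : IsFace n k F) (hy : y ∈ F)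
    (hyk : y ∈ (stratum n k : Set X)) : supp n F = facetsThrough n y := by
  refine Subset.antisymm (fun G hG => hG hy) fun G hyG => ?_
  rw [supp, mem_ofPred_eq, hF.eq_closure hX hy hyk]
  refine closure_minimal (fun z hz => ?_) G.2.isClosed
  rw [← mem_facetsThrough, facetsThrough_eq_of_isPreconnected hX isPreconnected_connectedComponentIn
    (connectedComponentIn_subset _ _) hz (mem_connectedComponentIn hyk)]
  exact hyG

end Faces

/-! ### Labelled charts -/

/-- A convex chart centred at `x` together with a labelling of the facets through `x` by the walls
of the corner: `wall G` is the index of the wall onto which the chart maps `G`. The values of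
`wall` at facets that do not contain `x` are irrelevant. Labelled charts exist because the facets
are embedded, and they turn the combinatorics of the strata near `x` into that of the sets
`facetsThrough n y`. -/
structure IsLabelledChart {X : Type*} [MetricSpace X] {n : ℕ} (N : Set X) (φ : X → Fin n → ℝ)
    (x : X) (wall : Facet n X → Fin n) : Prop extends IsConvexChart N φ x where
  injOn_wall : InjOn wall (facetsThrough n x)
  facetsThrough_subset : ∀ y ∈ N, facetsThrough n y ⊆ facetsThrough n x
  image_wall : ∀ y ∈ N, wall '' facetsThrough n y = zeroSet (φ y)

section LabelledCharts

variable {X : Type*} [MetricSpace X] {n k : ℕ} {N F W : Set X} {φ : X → Fin n → ℝ} {x y : X}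
  {wall : Facet n X → Fin n} {T : Set (Facet n X)}

theorem IsConvexChart.injective_of_facetsThrough_eq (hemb : EmbeddedFacets n X)
    (h : IsConvexChart N φ x) {g : zeroSet (φ x) → Facet n X}
    (hg : ∀ y ∈ N, facetsThrough n y = g '' {i | φ y i = 0}) : Function.Injective g := by
  by_contra! hinj
  obtain ⟨i, j, hij, hne⟩ : ∃ i j, g i = g j ∧ i ≠ j := by
    simpa only [Function.Injective, not_forall, exists_prop] using hinj
  obtain ⟨y, hy, hyz⟩ : ∃ y ∈ N, zeroSet (φ y) = {i.1, j.1} :=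
    closure_nonempty_iff.1 ⟨x, h.mem_closure_setOf_zeroSet_eq h.mem (pair_subset i.2 j.2)⟩
  have hy2 : y ∈ (stratum n 2 : Set X) :=
    (h.mem_stratum_iff hy).2 (by rw [hyz, ncard_pair (Subtype.coe_injective.ne hne)])
  have hfacet : ∀ G ∈ facetsThrough n y, G = g i := by
    rw [hg y hy]
    rintro _ ⟨l, hl, rfl⟩
    obtain hl | hl : l.1 ∈ ({i.1, j.1} : Set (Fin n)) := hyz ▸ mem_zeroSet.2 hl
    · rw [Subtype.ext hl]
    · rw [Subtype.ext hl, hij]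
  obtain ⟨G, H, hGH, hG, hH⟩ := hemb y hy2
  exact hGH ((hfacet G hG).trans (hfacet H hH).symm)

theorem Facet.nonempty_fin (G : Facet n X) : Nonempty (Fin n) := by
  obtain ⟨y, -, U, φ, -, -, hy⟩ := G.2.exists_mem_and_mem_stratum
  obtain ⟨i, -⟩ := nonempty_of_ncard_ne_zero (hy.trans_ne one_ne_zero)
  exact ⟨i⟩

theorem exists_isLabelledChart (hX : IsRightAngledManifold n X) (hemb : EmbeddedFacets n X)
    (hW : W ∈ 𝓝 x) : ∃ (N : Set X) (φ : X → Fin n → ℝ) (wall : Facet n X → Fin n),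
      IsLabelledChart N φ x wall ∧ N ⊆ W := by
  obtain ⟨N, φ, h, hNW⟩ := hX.exists_isConvexChart hW
  obtain ⟨g, hg⟩ := h.exists_facetsThrough_eq hX
  have hgx : facetsThrough n x = range g := by
    rw [hg x h.mem, ← image_univ]
    exact congrArg _ (eq_univ_of_forall fun i => i.2)
  have hginj := h.injective_of_facetsThrough_eq hemb hg
  let wall : Facet n X → Fin n :=
    Function.extend g Subtype.val fun G => Classical.choice G.nonempty_fin
  have hwall (i) : wall (g i) = i := hginj.extend_apply _ _ i
  refine ⟨N, φ, wall, ⟨h, ?_, fun y hy => ?_, fun y hy => ?_⟩, hNW⟩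
  · rw [hgx]
    rintro _ ⟨i, rfl⟩ _ ⟨j, rfl⟩ hij
    rw [hwall, hwall] at hij
    rw [Subtype.ext hij]
  · rw [hgx, hg y hy]
    exact image_subset_range _ _
  · rw [hg y hy, image_image]
    simp only [hwall]
    exact (Subtype.image_preimage_coe (zeroSet (φ x)) (zeroSet (φ y))).trans
      (inter_eq_right.2 (h.zeroSet_subset y hy))

theorem finite_facetsThrough (hX : IsRightAngledManifold n X) (x : X) :
    (facetsThrough n x).Finite := by
  obtain ⟨N, φ, h, -⟩ := hX.exists_isConvexChart (x := x) Filter.univ_mem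
  obtain ⟨g, hg⟩ := h.exists_facetsThrough_eq hX
  rw [hg x h.mem]
  exact toFinite _

theorem mem_stratum_iff_ncard_facetsThrough (hX : IsRightAngledManifold n X)
    (hemb : EmbeddedFacets n X) :
    x ∈ (stratum n k : Set X) ↔ (facetsThrough n x).ncard = k := by
  obtain ⟨N, φ, wall, h, -⟩ := exists_isLabelledChart hX hemb (x := x) Filter.univ_mem
  rw [h.mem_stratum_iff h.mem, ← h.image_wall x h.mem, h.injOn_wall.ncard_image]

theorem supp_subset_facetsThrough (hxF : x ∈ F) : supp n F ⊆ facetsThrough n x :=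
  fun _ hG => hG hxF

namespace IsLabelledChart

theorem setOf_facetsThrough_eq (h : IsLabelledChart N φ x wall) (hT : T ⊆ facetsThrough n x) :
    {y ∈ N | facetsThrough n y = T} = {y ∈ N | zeroSet (φ y) = wall '' T} := by
  ext y
  refine and_congr_right fun hy => ?_
  rw [← h.image_wall y hy, h.injOn_wall.image_eq_image_iff (h.facetsThrough_subset y hy) hT]

theorem isPreconnected_setOf_facetsThrough_eq (h : IsLabelledChart N φ x wall)
    (hT : T ⊆ facetsThrough n x) : IsPreconnected {y ∈ N | facetsThrough n y = T} := by
  rw [h.setOf_facetsThrough_eq hT]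
  exact h.isPreconnected_setOf_zeroSet_eq _

theorem mem_closure_setOf_facetsThrough_eq (h : IsLabelledChart N φ x wall)
    (hT : T ⊆ facetsThrough n x) : x ∈ closure {y ∈ N | facetsThrough n y = T} := by
  rw [h.setOf_facetsThrough_eq hT]
  refine h.mem_closure_setOf_zeroSet_eq h.mem ?_
  rw [← h.image_wall x h.mem]
  exact image_mono hT

theorem mem_iff_supp_subset (hX : IsRightAngledManifold n X) (h : IsLabelledChart N φ x wall)
    (hF : IsFace n k F) (hxF : x ∈ F) (hy : y ∈ N) :
    y ∈ F ↔ supp n F ⊆ facetsThrough n y := by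
  refine ⟨supp_subset_facetsThrough, fun hsub => ?_⟩
  obtain ⟨z, hz, hzF, -, hzk⟩ := hF.exists_zeroSet_subset h.toIsCornerChart h.mem hxF
  refine hF.mem_of_zeroSet_subset hX h.toIsConvexChart hz hzF hzk hy ?_
  rw [← h.image_wall y hy, ← h.image_wall z hz,
    ← hF.supp_eq_facetsThrough hX hzF ((h.mem_stratum_iff hz).2 hzk)]
  exact image_mono hsub

end IsLabelledChart

theorem IsFace.ncard_supp (hX : IsRightAngledManifold n X) (hemb : EmbeddedFacets n X)
    (hF : IsFace n k F) : (supp n F).ncard = k := by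
  obtain ⟨y, hyF, hyk⟩ := hF.exists_mem_and_mem_stratum
  rw [hF.supp_eq_facetsThrough hX hyF hyk]
  exact (mem_stratum_iff_ncard_facetsThrough hX hemb).1 hyk

end LabelledCharts

/-! ### Faces as manifolds -/

section CoordinateSubspace

variable {m n : ℕ} {e : Fin m → Fin n} {a b : Fin n → ℝ}

theorem hypDist_comp (he : Function.Injective e) (ha : (range e)ᶜ ⊆ zeroSet a)
    (hb : (range e)ᶜ ⊆ zeroSet b) : hypDist (a ∘ e) (b ∘ e) = hypDist a b := by
  have ha0 (i) (hi : i ∉ range e) : a i = 0 := ha hi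
  have hb0 (i) (hi : i ∉ range e) : b i = 0 := hb hi
  have hsum (f g : Fin n → ℝ) (hf : ∀ i ∉ range e, f i = 0) :
      ∑ i, (f ∘ e) i * (g ∘ e) i = ∑ i, f i * g i :=
    Fintype.sum_of_injective e he _ _ (fun i hi => by rw [hf i hi, zero_mul]) fun _ => rfl
  simp only [hypDist, sq, hsum a a ha0, hsum b b hb0, hsum a b ha0]

theorem ncard_zeroSet_comp_add (he : Function.Injective e) (ha : (range e)ᶜ ⊆ zeroSet a) :
    (zeroSet (a ∘ e)).ncard + (range e)ᶜ.ncard = (zeroSet a).ncard := by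
  have himage : e '' zeroSet (a ∘ e) = zeroSet a ∩ range e :=
    image_preimage_eq_inter_range (t := zeroSet a)
  rw [← ncard_image_of_injective _ he, himage,
    ← ncard_inter_add_ncard_sdiff_eq_ncard (zeroSet a) (range e), sdiff_eq, inter_eq_right.2 ha]

theorem continuous_extend_zero (he : Function.Injective e) :
    Continuous fun c : Fin m → ℝ => Function.extend e c 0 := by
  refine continuous_pi fun i => ?_
  by_cases hi : i ∈ range e
  · obtain ⟨j, rfl⟩ := hi
    simpa only [he.extend_apply] using continuous_apply j
  · simpa only [Function.extend_apply' _ _ _ hi] using continuous_const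

theorem exists_injective_range_eq {κ : Type*} {S : Set κ} [Finite S] (hS : S.ncard = m) :
    ∃ e : Fin m → κ, Function.Injective e ∧ range e = S := by
  let e : Fin m ≃ S := (Finite.equivFinOfCardEq hS).symm
  exact ⟨Subtype.val ∘ e, Subtype.val_injective.comp e.injective, by
    rw [range_comp, e.range_eq_univ, image_univ, Subtype.range_coe]⟩

theorem compl_range_subset_zeroSet_extend (c : Fin m → ℝ) :
    (range e)ᶜ ⊆ zeroSet (Function.extend e c 0) := fun _ hi => Function.extend_apply' _ _ _ hi

theorem extend_comp_of_compl_range_subset_zeroSet (he : Function.Injective e)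
    (ha : (range e)ᶜ ⊆ zeroSet a) : Function.extend e (a ∘ e) 0 = a := by
  ext i
  by_cases hi : i ∈ range e
  · obtain ⟨j, rfl⟩ := hi
    exact he.extend_apply _ _ _
  · rw [compl_range_subset_zeroSet_extend (a ∘ e) hi, ha hi]

theorem extend_zero_mem_corner_iff (he : Function.Injective e) {c : Fin m → ℝ} :
    Function.extend e c 0 ∈ corner n ↔ c ∈ corner m := by
  refine ⟨fun hc j => he.extend_apply c 0 j ▸ hc (e j), fun hc i => ?_⟩
  by_cases hi : i ∈ range e
  · obtain ⟨j, rfl⟩ := hi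
    rw [he.extend_apply]
    exact hc j
  · exact (compl_range_subset_zeroSet_extend c hi).ge

theorem IsCornerChart.restrict {X : Type*} [MetricSpace X] {N F : Set X} {φ : X → Fin n → ℝ}
    (h : IsCornerChart n N φ) (he : Function.Injective e)
    (hF : ∀ y ∈ N, y ∈ F ↔ (range e)ᶜ ⊆ zeroSet (φ y)) :
    IsCornerChart m (Subtype.val ⁻¹' N) fun y : F => φ y ∘ e where
  isOpen := h.isOpen.preimage continuous_subtype_val
  isometry y hy z hz := by
    rw [hypDist_comp he ((hF y hy).1 y.2) ((hF z hz).1 z.2)]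
    exact h.isometry y hy z hz
  image := by
    obtain ⟨O, hO, himage⟩ := h.image
    refine ⟨_, hO.preimage (continuous_extend_zero he), Set.ext fun c => ?_⟩
    rw [mem_inter_iff, mem_preimage, ← extend_zero_mem_corner_iff he, ← mem_inter_iff, ← himage]
    constructor
    · rintro ⟨y, hy, rfl⟩
      exact ⟨y, hy, (extend_comp_of_compl_range_subset_zeroSet he ((hF y hy).1 y.2)).symm⟩
    · rintro ⟨y, hy, hyc⟩
      have hyF : y ∈ F := (hF y hy).2 (hyc ▸ compl_range_subset_zeroSet_extend c)
      exact ⟨⟨y, hyF⟩, hy, (congrArg (· ∘ e) hyc).trans (Function.extend_comp he c 0)⟩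

end CoordinateSubspace

section FaceManifold

variable {X : Type*} [MetricSpace X] {n m k j : ℕ} {N F C : Set X} {φ : X → Fin n → ℝ}
  {wall : Facet n X → Fin n} {x : X}

theorem IsFace.subset_of_isPreconnected (hX : IsRightAngledManifold n X) (hF : IsFace n k F)
    (hC : IsPreconnected C) (hCk : C ⊆ stratum n k) (hxC : x ∈ C) (hxF : x ∈ F) : C ⊆ F := by
  rw [hF.eq_closure hX hxF (hCk hxC)]
  exact (hC.subset_connectedComponentIn hxC hCk).trans subset_closure

variable (hX : IsRightAngledManifold n X) (hemb : EmbeddedFacets n X) (hmk : m + k = n)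
  (hF : IsFace n k F)
include hX hemb hmk hF

theorem IsFace.exists_isCornerChart (x : F) : ∃ (N : Set F) (ψ : F → Fin m → ℝ),
    IsCornerChart m N ψ ∧ x ∈ N ∧
      ∀ y ∈ N, (zeroSet (ψ y)).ncard + k = (facetsThrough n y.1).ncard := by
  obtain ⟨N, φ, wall, h, -⟩ := exists_isLabelledChart hX hemb (x := x.1) Filter.univ_mem
  have hsupp : supp n F ⊆ facetsThrough n x.1 := supp_subset_facetsThrough x.2
  have hcard : (wall '' supp n F).ncard = k := by
    rw [(h.injOn_wall.mono hsupp).ncard_image, hF.ncard_supp hX hemb]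
  obtain ⟨e, he, hrange⟩ := exists_injective_range_eq (S := (wall '' supp n F)ᶜ) (m := m) (by
    rw [ncard_compl, hcard, Nat.card_fin, ← hmk, Nat.add_sub_cancel])
  have hrange' : (range e)ᶜ = wall '' supp n F := by rw [hrange, compl_compl]
  have hmem (y) (hy : y ∈ N) : y ∈ F ↔ (range e)ᶜ ⊆ zeroSet (φ y) := by
    rw [h.mem_iff_supp_subset hX hF x.2 hy, hrange', ← h.image_wall y hy,
      h.injOn_wall.image_subset_image_iff hsupp (h.facetsThrough_subset y hy)]
  refine ⟨_, _, h.restrict he hmem, h.mem, fun y hy => ?_⟩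
  rw [← hcard, ← hrange', ncard_zeroSet_comp_add he ((hmem y hy).1 y.2), ← h.image_wall y hy,
    (h.injOn_wall.mono (h.facetsThrough_subset y hy)).ncard_image]

theorem IsFace.isRightAngledManifold : IsRightAngledManifold m F := fun x =>
  have ⟨N, ψ, h, hx, _⟩ := hF.exists_isCornerChart hX hemb hmk x
  ⟨N, ψ, h, hx⟩

theorem IsFace.mem_stratum_iff {x : F} :
    x ∈ (stratum m j : Set F) ↔ x.1 ∈ (stratum n (j + k) : Set X) := by
  obtain ⟨N, ψ, h, hx, hcard⟩ := hF.exists_isCornerChart hX hemb hmk x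
  rw [h.mem_stratum_iff hx, mem_stratum_iff_ncard_facetsThrough hX hemb, ← hcard x hx,
    Nat.add_right_cancel_iff]

theorem IsFace.mem_stratum_iff_ncard_sdiff {x : F} :
    x ∈ (stratum m j : Set F) ↔ (facetsThrough n x.1 \ supp n F).ncard = j := by
  rw [hF.mem_stratum_iff hX hemb hmk, mem_stratum_iff_ncard_facetsThrough hX hemb,
    ← ncard_sdiff_add_ncard_of_subset (supp_subset_facetsThrough x.2) (finite_facetsThrough hX x.1),
    hF.ncard_supp hX hemb, Nat.add_right_cancel_iff]

theorem IsFace.mem_adj_iff {H : Facet n X} :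
    H ∈ adj n m F ↔ ∃ x ∈ F, H ∈ facetsThrough n x \ supp n F := by
  have hsupp {x : F} (hx : x ∈ interiorPoints m F) : supp n F = facetsThrough n x.1 :=
    hF.supp_eq_facetsThrough hX x.2 (by
      simpa only [zero_add] using (hF.mem_stratum_iff hX hemb hmk).1 hx)
  constructor
  · rintro ⟨⟨x, -, hxH⟩, hint⟩
    obtain ⟨y, hyF, hyk⟩ := hF.exists_mem_and_mem_stratum
    refine ⟨x, x.2, hxH, fun hH => hint ⟨y, hyF⟩ ?_ (hH hyF)⟩
    exact (hF.mem_stratum_iff hX hemb hmk).2 (by rwa [zero_add])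
  · rintro ⟨x, hx, hxH, hH⟩
    have hint : ∀ y ∈ interiorPoints m F, y.1 ∉ H.1 := fun y hy hyH => hH (hsupp hy ▸ hyH)
    exact ⟨⟨⟨x, hx⟩, fun hxint => hint _ hxint hxH, hxH⟩, hint⟩

end FaceManifold

/-! ### Facets of a face -/

/-- `π` is the natural map `Fac(F) → adj(F)`: the only facet in `adj(F)` containing the facet `G`
of `F` is `π G`. -/
def IsAdjMap {X : Type*} [MetricSpace X] {n m : ℕ} {F : Set X} (π : Facet m F → adj n m F) :
    Prop :=
  ∀ G H, Subtype.val '' G.1 ⊆ H.1.1 ↔ H = π G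

/-- The part in `N` of the codimension one stratum of `F` cut out by the facet `H`. -/
def facetPiece {X : Type*} [MetricSpace X] {n : ℕ} (N F : Set X) (H : Facet n X) : Set F :=
  {y | y.1 ∈ N ∧ facetsThrough n y.1 = insert H (supp n F)}

section FacetsOfFace

variable {X : Type*} [MetricSpace X] {n m k : ℕ} {N F : Set X} {φ : X → Fin n → ℝ}
  {wall : Facet n X → Fin n} {x : F} {G : Facet m F} {H : Facet n X}
  {π : Facet m F → adj n m F}

theorem IsLabelledChart.image_val_facetPiece (hX : IsRightAngledManifold n X)
    (hF : IsFace n k F) (h : IsLabelledChart N φ x.1 wall) :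
    Subtype.val '' facetPiece N F H = {y ∈ N | facetsThrough n y = insert H (supp n F)} := by
  ext y
  constructor
  · rintro ⟨y, hy, rfl⟩
    exact hy
  · rintro ⟨hyN, hy⟩
    exact ⟨⟨y, (h.mem_iff_supp_subset hX hF x.2 hyN).2 (hy ▸ subset_insert _ _)⟩, ⟨hyN, hy⟩, rfl⟩

theorem IsLabelledChart.isPreconnected_facetPiece (hX : IsRightAngledManifold n X)
    (hF : IsFace n k F) (h : IsLabelledChart N φ x.1 wall)
    (hH : x.1 ∈ H.1) : IsPreconnected (facetPiece N F H) := by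
  rw [← IsInducing.subtypeVal.isPreconnected_image, h.image_val_facetPiece hX hF]
  exact h.isPreconnected_setOf_facetsThrough_eq
    (insert_subset hH (supp_subset_facetsThrough x.2))

theorem IsLabelledChart.mem_closure_facetPiece (hX : IsRightAngledManifold n X)
    (hF : IsFace n k F) (h : IsLabelledChart N φ x.1 wall)
    (hH : x.1 ∈ H.1) : x ∈ closure (facetPiece N F H) := by
  rw [closure_subtype, h.image_val_facetPiece hX hF]
  exact h.mem_closure_setOf_facetsThrough_eq (insert_subset hH (supp_subset_facetsThrough x.2))

variable (hX : IsRightAngledManifold n X) (hemb : EmbeddedFacets n X) (hmk : m + k = n)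
  (hF : IsFace n k F)
include hX hemb hmk hF

theorem IsFace.image_val_subset_iff (hx : x ∈ G.1) (hx1 : x ∈ (stratum m 1 : Set F)) :
    Subtype.val '' G.1 ⊆ H.1 ↔ x.1 ∈ H.1 := by
  refine ⟨fun h => h (mem_image_of_mem _ hx), fun hxH => image_subset_iff.2 ?_⟩
  rw [G.2.eq_closure (hF.isRightAngledManifold hX hemb hmk) hx hx1]
  refine closure_minimal (fun y hy => ?_) (H.2.isClosed.preimage continuous_subtype_val)
  have hpre : IsPreconnected (Subtype.val '' connectedComponentIn (stratum m 1) x) :=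
    isPreconnected_connectedComponentIn.image _ continuous_subtype_val.continuousOn
  have hstratum : Subtype.val '' connectedComponentIn (stratum m 1) x ⊆ stratum n (1 + k) :=
    image_subset_iff.2 fun z hz =>
      (hF.mem_stratum_iff hX hemb hmk).1 (connectedComponentIn_subset _ _ hz)
  rw [mem_preimage, ← mem_facetsThrough, facetsThrough_eq_of_isPreconnected hX hpre hstratum
    (mem_image_of_mem _ hy) (mem_image_of_mem _ (mem_connectedComponentIn hx1))]
  exact hxH

theorem IsFace.exists_isAdjMap : ∃ π : Facet m F → adj n m F, IsAdjMap π := by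
  have hunique (G : Facet m F) :
      ∃ K : adj n m F, ∀ H : adj n m F, Subtype.val '' G.1 ⊆ H.1.1 ↔ H = K := by
    obtain ⟨x, hx, hx1⟩ := G.2.exists_mem_and_mem_stratum
    obtain ⟨K, hK⟩ := ncard_eq_one.1 ((hF.mem_stratum_iff_ncard_sdiff hX hemb hmk).1 hx1)
    have hadj {H : Facet n X} (hH : H ∈ facetsThrough n x.1 \ supp n F) : H ∈ adj n m F :=
      (hF.mem_adj_iff hX hemb hmk).2 ⟨x, x.2, hH⟩
    refine ⟨⟨K, hadj (hK ▸ mem_singleton K)⟩, fun H => ?_⟩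
    obtain ⟨-, -, -, hHsupp⟩ := (hF.mem_adj_iff hX hemb hmk).1 H.2
    rw [hF.image_val_subset_iff hX hemb hmk hx hx1, ← mem_facetsThrough, Subtype.ext_iff,
      ← mem_singleton_iff, ← hK, mem_sdiff, and_iff_left hHsupp]
  choose π hπ using hunique
  exact ⟨π, hπ⟩

theorem IsAdjMap.mapsTo (hπ : IsAdjMap π) (x : F) :
    MapsTo (fun G => (π G).1) (facetsThrough m x) (facetsThrough n x.1 \ supp n F) := by
  intro G hG
  obtain ⟨-, -, -, hsupp⟩ := (hF.mem_adj_iff hX hemb hmk).1 (π G).2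
  exact ⟨(hπ G (π G)).2 rfl (mem_image_of_mem _ hG), hsupp⟩

theorem IsAdjMap.facetsThrough_eq_insert (hπ : IsAdjMap π) (hx : x ∈ G.1)
    (hx1 : x ∈ (stratum m 1 : Set F)) :
    facetsThrough n x.1 = insert (π G).1 (supp n F) := by
  obtain ⟨K, hK⟩ := ncard_eq_one.1 ((hF.mem_stratum_iff_ncard_sdiff hX hemb hmk).1 hx1)
  have hπK : (π G).1 = K := hK.subset (hπ.mapsTo hX hemb hmk hF x hx)
  rw [hπK, ← union_sdiff_cancel (supp_subset_facetsThrough x.2), hK, union_singleton]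

theorem IsFace.facetPiece_subset_stratum (hH : H ∉ supp n F) :
    facetPiece N F H ⊆ stratum m 1 := fun y hy => by
  rw [hF.mem_stratum_iff_ncard_sdiff hX hemb hmk, hy.2, insert_sdiff_of_notMem _ hH,
    Set.sdiff_self, insert_empty_eq, ncard_singleton]

theorem IsLabelledChart.facetPiece_subset (h : IsLabelledChart N φ x.1 wall)
    (hH : H ∈ facetsThrough n x.1 \ supp n F) {y : F} (hy : y ∈ facetPiece N F H)
    (hyG : y ∈ G.1) : facetPiece N F H ⊆ G.1 :=
  G.2.subset_of_isPreconnected (hF.isRightAngledManifold hX hemb hmk)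
    (h.isPreconnected_facetPiece hX hF hH.1)
    (hF.facetPiece_subset_stratum hX hemb hmk hH.2) hy hyG

theorem IsLabelledChart.facetPiece_adjMap_subset (hπ : IsAdjMap π)
    (h : IsLabelledChart N φ x.1 wall) (hx : x ∈ G.1) : facetPiece N F (π G).1 ⊆ G.1 := by
  obtain ⟨y, hyN, hyG, hy1⟩ := G.2.exists_mem_stratum hx
    ((h.isOpen.preimage continuous_subtype_val).mem_nhds h.mem)
  exact h.facetPiece_subset hX hemb hmk hF (hπ.mapsTo hX hemb hmk hF x hx)
    ⟨hyN, hπ.facetsThrough_eq_insert hX hemb hmk hF hyG hy1⟩ hyG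

theorem IsAdjMap.bijOn (hπ : IsAdjMap π) (x : F) :
    BijOn (fun G => (π G).1) (facetsThrough m x) (facetsThrough n x.1 \ supp n F) := by
  obtain ⟨N, φ, wall, h, -⟩ := exists_isLabelledChart hX hemb (x := x.1) Filter.univ_mem
  have hnonempty {H} (hH : H ∈ facetsThrough n x.1 \ supp n F) : (facetPiece N F H).Nonempty :=
    closure_nonempty_iff.1 ⟨x, h.mem_closure_facetPiece hX hF hH.1⟩
  have hmaps := hπ.mapsTo hX hemb hmk hF x
  refine ⟨hmaps, fun G hG G' hG' (hGG' : (π G).1 = (π G').1) => ?_, fun H hH => ?_⟩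
  · obtain ⟨y, hy⟩ := hnonempty (hmaps hG)
    have hyG : y ∈ G.1 := h.facetPiece_adjMap_subset hX hemb hmk hF hπ hG hy
    have hyG' : y ∈ G'.1 := h.facetPiece_adjMap_subset hX hemb hmk hF hπ hG' (hGG' ▸ hy)
    exact Subtype.ext <| G.2.eq_of_mem_stratum (hF.isRightAngledManifold hX hemb hmk) G'.2 hyG hyG'
      (hF.facetPiece_subset_stratum hX hemb hmk (hmaps hG).2 hy)
  · obtain ⟨y, hy⟩ := hnonempty hH
    have hy1 := hF.facetPiece_subset_stratum hX hemb hmk hH.2 hy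
    obtain ⟨G, hG, hyG⟩ := exists_isFace_of_mem_stratum hy1
    refine ⟨⟨G, hG⟩, closure_minimal (h.facetPiece_subset (G := ⟨G, hG⟩) hX hemb hmk hF hH hy hyG)
      hG.isClosed (h.mem_closure_facetPiece hX hF hH.1), ?_⟩
    have hπy : (π ⟨G, hG⟩).1 ∈ facetsThrough n y.1 \ supp n F := hπ.mapsTo hX hemb hmk hF y hyG
    rw [hy.2] at hπy
    exact hπy.1.resolve_right hπy.2

theorem IsAdjMap.surjective (hπ : IsAdjMap π) : Function.Surjective π := fun H => by
  obtain ⟨x, hx, hH⟩ := (hF.mem_adj_iff hX hemb hmk).1 H.2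
  obtain ⟨G, -, hG⟩ := (hπ.bijOn hX hemb hmk hF ⟨x, hx⟩).surjOn hH
  exact ⟨G, Subtype.ext hG⟩

theorem IsFace.embeddedFacets : EmbeddedFacets m F := fun x hx => by
  obtain ⟨π, hπ⟩ := hF.exists_isAdjMap hX hemb hmk
  have hcard : (facetsThrough m x).ncard = 2 := by
    rw [← (hF.mem_stratum_iff_ncard_sdiff hX hemb hmk).1 hx,
      ← (hπ.bijOn hX hemb hmk hF x).image_eq, (hπ.bijOn hX hemb hmk hF x).injOn.ncard_image]
  obtain ⟨G, H, hGH, hx⟩ := ncard_eq_two.1 hcard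
  exact ⟨G, H, hGH, hx.superset (mem_insert _ _), hx.superset (mem_insert_of_mem _ rfl)⟩

theorem IsAdjMap.image_facetsThrough {V : Type*} {lam : Facet n X → V} (hπ : IsAdjMap π) (x : F) :
    lam '' supp n F ∪ (fun G => lam (π G).1) '' facetsThrough m x = lam '' facetsThrough n x.1 := by
  rw [← image_image lam fun G => (π G).1, (hπ.bijOn hX hemb hmk hF x).image_eq, ← image_union,
    union_sdiff_cancel (supp_subset_facetsThrough x.2)]

variable {V : Type*} [AddCommGroup V] [Module (ZMod 2) V] {lam : Facet n X → V}

theorem IsAdjMap.isColoring_inducedColoring (hπ : IsAdjMap π) (hlam : IsColoring n X lam) :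
    IsColoring m F (inducedColoring F lam π) := fun x => by
  have hx : LinearIndepOn (ZMod 2) lam (supp n F ∪ (facetsThrough n x.1 \ supp n F)) := by
    rw [union_sdiff_cancel (supp_subset_facetsThrough x.2)]
    exact hlam x
  rw [linearIndepOn_union_iff_quotient disjoint_sdiff_right,
    ← (hπ.bijOn hX hemb hmk hF x).image_eq] at hx
  exact hx.2.comp_of_image (hπ.bijOn hX hemb hmk hF x).injOn

end FacetsOfFace

namespace RealToric

/-! ### The real toric space and its gluing metric -/

section Basic

variable {V : Type*} [AddCommGroup V] {n : ℕ} {X Z : Type*} [MetricSpace X] [TopologicalSpace Z]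
  {lam : Facet n X → V} {p q r : RealToric n X lam} {l l' : ℝ≥0∞} {v w : V} {x y : X}

theorem exists_eq_mk (p : RealToric n X lam) : ∃ v x, p = mk lam v x := by
  obtain ⟨⟨v, x⟩, rfl⟩ := Quot.exists_rep p
  exact ⟨v, x, rfl⟩

theorem mk_add (hu : w ∈ AddSubgroup.closure (lam '' facetsThrough n x)) (v : V) :
    mk lam (v + w) x = mk lam v x := by
  induction hu using AddSubgroup.closure_induction generalizing v with
  | mem u hu =>
    obtain ⟨G, hG, rfl⟩ := hu
    exact (Quot.sound (Glue.glue v G x hG)).symm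
  | zero => rw [add_zero]
  | add u u' _ _ ihu ihu' => rw [← add_assoc, ihu', ihu]
  | neg u _ ihu => rw [← ihu, neg_add_cancel_right]

theorem mk_eq_mk_iff :
    mk lam v x = mk lam w y ↔
      x = y ∧ w - v ∈ AddSubgroup.closure (lam '' facetsThrough n x) := by
  constructor
  · let colorClass :
        RealToric n X lam → Σ x : X, V ⧸ AddSubgroup.closure (lam '' facetsThrough n x) :=
      Quot.lift (fun p => ⟨p.2, p.1⟩) (by
        rintro _ _ ⟨v, G, x, hG⟩
        refine congrArg (Sigma.mk x) ((QuotientAddGroup.mk_add_of_mem v ?_).symm)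
        exact AddSubgroup.subset_closure (mem_image_of_mem lam hG))
    intro h
    obtain ⟨rfl, hvw⟩ := Sigma.mk.inj_iff.1 (congrArg colorClass h)
    refine ⟨rfl, ?_⟩
    rw [sub_eq_neg_add]
    exact QuotientAddGroup.eq.1 (eq_of_heq hvw)
  · rintro ⟨rfl, h⟩
    rw [← mk_add h v, add_sub_cancel]

theorem mk_eq_mk_of_facetsThrough_subset (h : mk lam v x = mk lam w x)
    (hxy : facetsThrough n x ⊆ facetsThrough n y) : mk lam v y = mk lam w y :=
  mk_eq_mk_iff.2 ⟨rfl, AddSubgroup.closure_mono (image_mono hxy) (mk_eq_mk_iff.1 h).2⟩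

theorem continuous_iff {f : RealToric n X lam → Z} :
    Continuous f ↔ ∀ v, Continuous fun x => f (mk lam v x) :=
  isQuotientMap_quot_mk.continuous_iff.trans continuous_sigma_iff

theorem continuous_mk (v : V) : Continuous (mk lam v) := continuous_iff.1 continuous_id v

theorem isClosed_iff {C : Set (RealToric n X lam)} :
    IsClosed C ↔ ∀ v, IsClosed (mk lam v ⁻¹' C) :=
  isQuotientMap_quot_mk.isClosed_preimage.symm.trans isClosed_sigma_iff

theorem HasChain.trans (hpq : HasChain p q l) (hqr : HasChain q r l') :
    HasChain p r (l + l') := by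
  induction hqr with
  | refl => rwa [add_zero]
  | step v x y l' _ ih =>
    rw [← add_assoc]
    exact ih.step v x y _

theorem hasChain_mk (v : V) (x y : X) : HasChain (mk lam v x) (mk lam v y) (edist x y) := by
  simpa only [zero_add] using HasChain.refl.step v x y 0

theorem HasChain.symm (h : HasChain p q l) : HasChain q p l := by
  induction h with
  | refl => exact .refl
  | step v x y l _ ih =>
    rw [edist_comm, add_comm]
    exact (hasChain_mk v y x).trans ih

theorem HasChain.edist_proj_le (h : HasChain p q l) : edist (proj p) (proj q) ≤ l := by
  induction h with
  | refl => rw [edist_self]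
  | step v x y l _ ih => exact (edist_triangle _ x y).trans (add_le_add_left ih _)

theorem glueDist_le (h : HasChain p q l) : glueDist p q ≤ l := sInf_le h

theorem glueDist_self (p : RealToric n X lam) : glueDist p p = 0 :=
  nonpos_iff_eq_zero.1 (glueDist_le .refl)

theorem glueDist_comm (p q : RealToric n X lam) : glueDist p q = glueDist q p :=
  congrArg sInf (Set.ext fun _ => ⟨.symm, .symm⟩)

theorem glueDist_triangle (p q r : RealToric n X lam) :
    glueDist p r ≤ glueDist p q + glueDist q r := by
  have hleft {l} (hl : HasChain p q l) : glueDist p r ≤ l + glueDist q r := by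
    rw [glueDist, glueDist, ENNReal.add_sInf]
    exact le_iInf₂ fun l' hl' => sInf_le (hl.trans hl')
  rw [glueDist, glueDist, ENNReal.sInf_add]
  exact le_iInf₂ fun l hl => hleft hl

theorem edist_proj_le_glueDist (p q : RealToric n X lam) :
    edist (proj p) (proj q) ≤ glueDist p q :=
  le_sInf fun _ => HasChain.edist_proj_le

theorem continuous_glueDist_left (p : RealToric n X lam) : Continuous (glueDist p) := by
  refine continuous_iff.2 fun v => continuous_of_le_add_edist 1 ENNReal.one_ne_top fun x y => ?_
  rw [one_mul, edist_comm]
  exact (glueDist_triangle _ _ _).trans (add_le_add_right (glueDist_le (hasChain_mk v y x)) _)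

end Basic

/-! ### The real toric space of a face -/

theorem mk_eq_mk_iff_span {V : Type*} [AddCommGroup V] [Module (ZMod 2) V] {n : ℕ} {X : Type*}
    [MetricSpace X] {lam : Facet n X → V} {v w : V} {x y : X} :
    mk lam v x = mk lam w y ↔
      x = y ∧ w - v ∈ Submodule.span (ZMod 2) (lam '' facetsThrough n x) := by
  have hspan (s : Set V) : Submodule.span (ZMod 2) s =
      AddSubgroup.toZModSubmodule 2 (AddSubgroup.closure s) :=
    le_antisymm (Submodule.span_le.2 AddSubgroup.subset_closure)
      ((AddSubgroup.closure_le (Submodule.span (ZMod 2) s).toAddSubgroup).2 Submodule.subset_span)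
  rw [mk_eq_mk_iff, hspan, AddSubgroup.mem_toZModSubmodule]

section FaceMap

variable {V : Type*} [AddCommGroup V] [Module (ZMod 2) V] {n m k : ℕ} {X : Type*} [MetricSpace X]
  {lam : Facet n X → V} {F : Set X} {π : Facet m F → adj n m F} {l : ℝ≥0∞}

/-- The map `M(F, lam_F) → M(X, lam)`, `[v̄, x] ↦ [v, x]`. -/
def faceMap (lam : Facet n X → V) (hπ : IsAdjMap π) :
    RealToric m F (inducedColoring F lam π) → RealToric n X lam :=
  Quot.lift
    (fun p => Quotient.liftOn' p.1 (fun v => mk lam v p.2.1) fun v w hvw => by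
      refine mk_eq_mk_iff_span.2 ⟨rfl, ?_⟩
      rw [sub_eq_neg_add]
      exact Submodule.span_mono (image_mono (supp_subset_facetsThrough p.2.2))
        (QuotientAddGroup.leftRel_apply.1 hvw))
    (by
      rintro _ _ ⟨v, G, x, hG⟩
      obtain ⟨v, rfl⟩ := Submodule.Quotient.mk_surjective _ v
      have hx : x.1 ∈ (π G).1.1 := (hπ G (π G)).2 rfl (mem_image_of_mem _ hG)
      exact Quot.sound (Glue.glue v (π G).1 x.1 hx))

theorem faceMap_mk (hπ : IsAdjMap π) (v : V) (x : F) :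
    faceMap lam hπ (mk _ (Submodule.Quotient.mk v) x) = mk lam v x := rfl

theorem exists_eq_mk_quotient (p : RealToric m F (inducedColoring F lam π)) :
    ∃ (v : V) (x : F), p = mk _ (Submodule.Quotient.mk v) x := by
  obtain ⟨v, x, rfl⟩ := exists_eq_mk p
  obtain ⟨v, rfl⟩ := Submodule.Quotient.mk_surjective _ v
  exact ⟨v, x, rfl⟩

theorem proj_faceMap (hπ : IsAdjMap π) (p : RealToric m F (inducedColoring F lam π)) :
    proj (faceMap lam hπ p) = proj p := by
  obtain ⟨v, x, rfl⟩ := exists_eq_mk_quotient p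
  rfl

theorem continuous_faceMap (hπ : IsAdjMap π) : Continuous (faceMap lam hπ) := by
  refine continuous_iff.2 fun v => ?_
  obtain ⟨v, rfl⟩ := Submodule.Quotient.mk_surjective _ v
  exact (continuous_mk v).comp continuous_subtype_val

theorem range_faceMap (hπ : IsAdjMap π) : range (faceMap lam hπ) = proj ⁻¹' F := by
  refine Subset.antisymm ?_ fun p hp => ?_
  · rintro _ ⟨p, rfl⟩
    rw [mem_preimage, proj_faceMap]
    exact (proj p).2
  · obtain ⟨v, x, rfl⟩ := exists_eq_mk p
    exact ⟨mk _ (Submodule.Quotient.mk v) ⟨x, hp⟩, rfl⟩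

theorem HasChain.faceMap (hπ : IsAdjMap π) {p q : RealToric m F (inducedColoring F lam π)}
    (h : HasChain p q l) : HasChain (faceMap lam hπ p) (faceMap lam hπ q) l := by
  induction h with
  | refl => exact .refl
  | step v x y l _ ih =>
    obtain ⟨v, rfl⟩ := Submodule.Quotient.mk_surjective _ v
    exact ih.step v x.1 y.1 l

theorem glueDist_faceMap_le (hπ : IsAdjMap π) (p q : RealToric m F (inducedColoring F lam π)) :
    glueDist (faceMap lam hπ p) (faceMap lam hπ q) ≤ glueDist p q :=
  le_sInf fun _ h => glueDist_le (h.faceMap hπ)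

variable (hX : IsRightAngledManifold n X) (hemb : EmbeddedFacets n X) (hmk : m + k = n)
  (hF : IsFace n k F)
include hX hemb hmk hF

theorem faceMap_injective (hπ : IsAdjMap π) : Function.Injective (faceMap lam hπ) := by
  intro p q hpq
  obtain ⟨v, x, rfl⟩ := exists_eq_mk_quotient p
  obtain ⟨w, y, rfl⟩ := exists_eq_mk_quotient q
  obtain ⟨hxy, hvw⟩ := mk_eq_mk_iff_span.1 hpq
  refine mk_eq_mk_iff_span.2 ⟨Subtype.ext hxy, ?_⟩
  rw [← hπ.image_facetsThrough hX hemb hmk hF, Submodule.span_union] at hvw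
  obtain ⟨a, ha, b, hb, hab⟩ := Submodule.mem_sup.1 hvw
  have hvw' : (Submodule.span (ZMod 2) (lam '' supp n F)).mkQ (w - v) =
      (Submodule.span (ZMod 2) (lam '' supp n F)).mkQ b := by
    rw [← hab, map_add, Submodule.mkQ_apply _ a, (Submodule.Quotient.mk_eq_zero _).2 ha, zero_add]
  have himage := Submodule.mem_map_of_mem (f := (Submodule.span (ZMod 2) (lam '' supp n F)).mkQ) hb
  rw [← hvw', Submodule.map_span, image_image] at himage
  exact himage

theorem isClosedMap_faceMap (hπ : IsAdjMap π) : IsClosedMap (faceMap lam hπ) := by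
  intro C hC
  refine isClosed_iff.2 fun v => ?_
  have hpreimage : mk lam v ⁻¹' (faceMap lam hπ '' C) =
      Subtype.val '' (mk _ (Submodule.Quotient.mk v) ⁻¹' C) := by
    ext x
    constructor
    · rintro ⟨p, hp, hpx⟩
      have hx : x ∈ F := by
        rw [← show proj (faceMap lam hπ p) = x from congrArg proj hpx, proj_faceMap]
        exact (proj p).2
      refine ⟨⟨x, hx⟩, ?_, rfl⟩
      have hp_eq : p = mk _ (Submodule.Quotient.mk v) ⟨x, hx⟩ :=
        faceMap_injective hX hemb hmk hF hπ hpx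
      rwa [mem_preimage, ← hp_eq]
    · rintro ⟨x, hx, rfl⟩
      exact ⟨_, hx, rfl⟩
  rw [hpreimage]
  exact hF.isClosed.isClosedMap_subtype_val _ (isClosed_iff.1 hC _)

theorem isClosedEmbedding_faceMap (hπ : IsAdjMap π) : IsClosedEmbedding (faceMap lam hπ) :=
  .of_continuous_injective_isClosedMap (continuous_faceMap hπ)
    (faceMap_injective hX hemb hmk hF hπ) (isClosedMap_faceMap hX hemb hmk hF hπ)

/-- The homeomorphism from `M(F, lam_F)` onto the preimage of `F` in `M(X, lam)` induced by
`faceMap`. -/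
noncomputable def faceHomeomorph (lam : Facet n X → V) (hπ : IsAdjMap π) :
    RealToric m F (inducedColoring F lam π) ≃ₜ (proj ⁻¹' F : Set (RealToric n X lam)) :=
  (isClosedEmbedding_faceMap hX hemb hmk hF hπ).isEmbedding.toHomeomorph.trans
    (Homeomorph.setCongr (range_faceMap hπ))

end FaceMap

end RealToric

/-! ### Local retractions onto a face -/

section OrthogonalProjection

variable {ι : Type*} [Fintype ι] {n : ℕ} {S : Set ι} {a b : ι → ℝ}

/-- The orthogonal projection of the hyperboloid onto the totally geodesic subspace on which the
coordinates in `S` vanish: they are set to `0`, and the resulting vector of `ℝ × ℝⁿ` is rescaled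
back to the hyperboloid. -/
noncomputable def orthProj (S : Set ι) (a : ι → ℝ) : ι → ℝ :=
  (timeCoord (S.indicator a))⁻¹ • Sᶜ.indicator a

theorem dotProduct_eq_indicator_add (S : Set ι) (a b : ι → ℝ) :
    a ⬝ᵥ b = S.indicator a ⬝ᵥ S.indicator b + Sᶜ.indicator a ⬝ᵥ Sᶜ.indicator b := by
  simp only [dotProduct, ← indicator_mul, ← Finset.sum_add_distrib]
  exact Finset.sum_congr rfl fun i _ =>
    (indicator_self_add_compl_apply S (fun j => a j * b j) i).symm

theorem timeCoord_orthProj (S : Set ι) (a : ι → ℝ) :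
    timeCoord (orthProj S a) = timeCoord a / timeCoord (S.indicator a) := by
  have hpos := timeCoord_pos (S.indicator a)
  refine timeCoord_eq_of_sq (div_pos (timeCoord_pos a) hpos).le ?_
  have hsum := dotProduct_eq_indicator_add S a a
  rw [orthProj, smul_dotProduct, dotProduct_smul, div_pow, timeCoord_sq a, hsum]
  simp only [smul_eq_mul]
  field_simp
  rw [timeCoord_sq]
  ring

theorem lorentz_orthProj (S : Set ι) (a b : ι → ℝ) :
    lorentz (orthProj S a) (orthProj S b) =
      (lorentz a b + S.indicator a ⬝ᵥ S.indicator b) /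
        (timeCoord (S.indicator a) * timeCoord (S.indicator b)) := by
  have ha := timeCoord_pos (S.indicator a)
  have hb := timeCoord_pos (S.indicator b)
  rw [lorentz, timeCoord_orthProj, timeCoord_orthProj, lorentz, dotProduct_eq_indicator_add S a b,
    orthProj, orthProj, smul_dotProduct, dotProduct_smul]
  simp only [smul_eq_mul]
  field_simp
  ring

theorem lorentz_orthProj_le (S : Set ι) (a b : ι → ℝ) :
    lorentz (orthProj S a) (orthProj S b) ≤ lorentz a b := by
  have huv : 1 ≤ timeCoord (S.indicator a) * timeCoord (S.indicator b) :=
    one_le_mul_of_one_le_of_one_le (one_le_timeCoord _) (one_le_timeCoord _)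
  have hlor : 1 ≤ timeCoord (S.indicator a) * timeCoord (S.indicator b) -
      S.indicator a ⬝ᵥ S.indicator b := one_le_lorentz _ _
  rw [lorentz_orthProj, div_le_iff₀ (zero_lt_one.trans_le huv)]
  nlinarith [mul_nonneg (sub_nonneg.2 (one_le_lorentz a b)) (sub_nonneg.2 huv)]

theorem hypDist_orthProj_le (S : Set (Fin n)) (a b : Fin n → ℝ) :
    hypDist (orthProj S a) (orthProj S b) ≤ hypDist a b :=
  hypDist_le_iff.2 (lorentz_orthProj_le S a b)

theorem continuous_orthProj (S : Set ι) : Continuous (orthProj S) := by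
  have hindicator (T : Set ι) : Continuous fun a : ι → ℝ => T.indicator a :=
    continuous_pi fun i => by
      by_cases hi : i ∈ T
      · simpa only [indicator_of_mem hi] using continuous_apply i
      · simpa only [indicator_of_notMem hi] using continuous_const
  exact ((continuous_timeCoord.comp (hindicator S)).inv₀ fun a => (timeCoord_pos _).ne').smul
    (hindicator Sᶜ)

theorem orthProj_mem_corner {S : Set (Fin n)} {a : Fin n → ℝ} (ha : a ∈ corner n) :
    orthProj S a ∈ corner n := fun i =>
  mul_nonneg (inv_nonneg.2 (timeCoord_pos _).le) (indicator_apply_nonneg fun _ => ha i)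

theorem orthProj_eq_self (ha : S ⊆ zeroSet a) : orthProj S a = a := by
  have hzero : S.indicator a = 0 :=
    indicator_eq_zero.2 (disjoint_right.2 fun i hi hne => hne (ha hi))
  have hcompl := indicator_compl_add_self S a
  rw [hzero, add_zero] at hcompl
  rw [orthProj, hcompl, hzero, timeCoord, zero_dotProduct, add_zero, Real.sqrt_one, inv_one,
    one_smul]

theorem zeroSet_orthProj (S : Set ι) (a : ι → ℝ) : zeroSet (orthProj S a) = S ∪ zeroSet a := by
  ext i
  have hpos := (inv_pos.2 (timeCoord_pos (S.indicator a))).ne'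
  by_cases hi : i ∈ S <;> simp [orthProj, hi, hpos]

end OrthogonalProjection

/-- On `W`, the map `R` to `F` does not increase distances, fixes the points of `F`, and does not
leave any facet. The last condition makes it compatible with the gluings of the real toric spaces of
`X` and `F`, so that chains inside `W` can be pushed into `F`. -/
structure IsFaceRetraction {X : Type*} [MetricSpace X] (n : ℕ) {F : Set X} (W : Set X)
    (R : X → F) : Prop where
  edist_le : ∀ y ∈ W, ∀ z ∈ W, edist (R y) (R z) ≤ edist y z
  eq_self : ∀ y : F, y.1 ∈ W → R y = y
  facetsThrough_subset : ∀ y ∈ W, facetsThrough n y ⊆ facetsThrough n (R y).1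

section Retraction

variable {X : Type*} [MetricSpace X] {n k : ℕ} {F : Set X}

theorem IsCornerChart.eventually_orthProj_mem_image {U : Set X} {φ : X → Fin n → ℝ} {x : X}
    {S : Set (Fin n)} (h : IsCornerChart n U φ) (hx : x ∈ U) (hS : S ⊆ zeroSet (φ x)) :
    ∀ᶠ y in 𝓝 x, orthProj S (φ y) ∈ φ '' U := by
  have himage := h.image_mem_nhdsWithin hx Filter.univ_mem
  rw [inter_univ, ← orthProj_eq_self hS] at himage
  have htendsto : Filter.Tendsto (orthProj S ∘ φ) (𝓝 x) (𝓝[corner n] orthProj S (φ x)) :=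
    tendsto_nhdsWithin_iff.2
      ⟨(continuous_orthProj S).continuousAt.comp (h.continuousAt hx),
        Filter.eventually_of_mem (h.isOpen.mem_nhds hx) fun y hy =>
          orthProj_mem_corner (h.mem_corner hy)⟩
  exact htendsto himage

theorem IsFace.exists_isFaceRetraction (hX : IsRightAngledManifold n X) (hemb : EmbeddedFacets n X)
    (hF : IsFace n k F) (x : F) : ∃ W ∈ 𝓝 x.1, ∃ R : X → F, IsFaceRetraction n W R := by
  obtain ⟨N, φ, wall, h, -⟩ := exists_isLabelledChart hX hemb (x := x.1) Filter.univ_mem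
  have : Nonempty F := ⟨x⟩
  have hsupp : supp n F ⊆ facetsThrough n x.1 := supp_subset_facetsThrough x.2
  have hvanish {y} (hyF : y ∈ F) (hy : y ∈ N) : wall '' supp n F ⊆ zeroSet (φ y) := by
    rw [← h.image_wall y hy]
    exact image_mono (supp_subset_facetsThrough hyF)
  have hW : {y ∈ N | orthProj (wall '' supp n F) (φ y) ∈ φ '' N} ∈ 𝓝 x.1 :=
    Filter.inter_mem (h.isOpen.mem_nhds h.mem)
      (h.eventually_orthProj_mem_image h.mem (hvanish x.2 h.mem))
  have hproj : ∀ y ∈ {y ∈ N | orthProj (wall '' supp n F) (φ y) ∈ φ '' N},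
      ∃ z : F, z.1 ∈ N ∧ φ z.1 = orthProj (wall '' supp n F) (φ y) := by
    rintro y ⟨-, z, hz, hzy⟩
    refine ⟨⟨z, (h.mem_iff_supp_subset hX hF x.2 hz).2 ?_⟩, hz, hzy⟩
    rw [← h.injOn_wall.image_subset_image_iff hsupp (h.facetsThrough_subset z hz),
      h.image_wall z hz, hzy, zeroSet_orthProj]
    exact subset_union_left
  choose! R hRN hR using hproj
  refine ⟨_, hW, R, ⟨fun y hy z hz => ?_, fun y hy => ?_, fun y hy => ?_⟩⟩
  · rw [Subtype.edist_eq, edist_dist, edist_dist, h.isometry _ (hRN y hy) _ (hRN z hz), hR y hy,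
      hR z hz, h.isometry y hy.1 z hz.1]
    exact ENNReal.ofReal_le_ofReal (hypDist_orthProj_le _ _ _)
  · refine Subtype.ext (h.injOn (hRN y hy) hy.1 ?_)
    rw [hR y hy]
    exact orthProj_eq_self (hvanish y.2 hy.1)
  · rw [← h.injOn_wall.image_subset_image_iff (h.facetsThrough_subset y hy.1)
      (h.facetsThrough_subset _ (hRN y hy)), h.image_wall y hy.1, h.image_wall _ (hRN y hy),
      hR y hy, zeroSet_orthProj]
    exact subset_union_right

end Retraction

namespace RealToric

/-! ### The inclusion of a face is a local isometry -/

section LocalIsometry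

variable {V : Type*} [AddCommGroup V] [Module (ZMod 2) V] {n m k : ℕ} {X : Type*} [MetricSpace X]
  {lam : Facet n X → V} {F W : Set X} {π : Facet m F → adj n m F} {R : X → F} {v w : V} {y z : X}
  {l : ℝ≥0∞}
  (hX : IsRightAngledManifold n X) (hemb : EmbeddedFacets n X) (hmk : m + k = n)
  (hF : IsFace n k F)
include hX hemb hmk hF

theorem mk_retraction_eq_mk_retraction (hπ : IsAdjMap π) (hR : IsFaceRetraction n W R)
    (hy : y ∈ W) (h : mk lam v y = mk lam w z) :
    mk (inducedColoring F lam π) (Submodule.Quotient.mk v) (R y) =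
      mk _ (Submodule.Quotient.mk w) (R z) := by
  obtain ⟨rfl, -⟩ := mk_eq_mk_iff.1 h
  exact faceMap_injective hX hemb hmk hF hπ
    (mk_eq_mk_of_facetsThrough_subset h (hR.facetsThrough_subset y hy))

theorem glueDist_retraction_le (hπ : IsAdjMap π) (hR : IsFaceRetraction n W R)
    {q : RealToric n X lam} (h : HasChain (mk lam v y) q l) (hW : ∀ u, edist y u ≤ l → u ∈ W)
    (hq : q = mk lam w z) :
    glueDist (mk (inducedColoring F lam π) (Submodule.Quotient.mk v) (R y))
      (mk _ (Submodule.Quotient.mk w) (R z)) ≤ l := by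
  induction h generalizing w z with
  | refl =>
    have hy : y ∈ W := hW y (edist_self y).le
    rw [mk_retraction_eq_mk_retraction hX hemb hmk hF hπ hR hy hq, glueDist_self]
  | step w' u u' l h ih =>
    have hu : edist y u ≤ l := h.edist_proj_le
    have huW : u ∈ W := hW u (hu.trans le_self_add)
    have hu'W : u' ∈ W := hW u' ((edist_triangle y u u').trans (add_le_add_left hu _))
    rw [← mk_retraction_eq_mk_retraction hX hemb hmk hF hπ hR hu'W hq]
    calc glueDist (mk (inducedColoring F lam π) (Submodule.Quotient.mk v) (R y))
          (mk _ (Submodule.Quotient.mk w') (R u'))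
        ≤ glueDist (mk _ (Submodule.Quotient.mk v) (R y)) (mk _ (Submodule.Quotient.mk w') (R u)) +
          glueDist (mk _ (Submodule.Quotient.mk w') (R u))
            (mk _ (Submodule.Quotient.mk w') (R u')) := glueDist_triangle _ _ _
      _ ≤ l + edist (R u) (R u') :=
        add_le_add (ih (fun a ha => hW a (ha.trans le_self_add)) rfl)
          (glueDist_le (hasChain_mk _ _ _))
      _ ≤ l + edist u u' := add_le_add_right (hR.edist_le u huW u' hu'W) _

theorem glueDist_le_of_hasChain_faceMap (hπ : IsAdjMap π) (hR : IsFaceRetraction n W R)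
    {p q : RealToric m F (inducedColoring F lam π)}
    (h : HasChain (faceMap lam hπ p) (faceMap lam hπ q) l)
    (hW : ∀ u, edist (proj p).1 u ≤ l → u ∈ W) : glueDist p q ≤ l := by
  obtain ⟨v, x, rfl⟩ := exists_eq_mk_quotient p
  obtain ⟨w, y, rfl⟩ := exists_eq_mk_quotient q
  have hxW : x.1 ∈ W := hW x ((edist_self x.1).trans_le zero_le)
  have hyW : y.1 ∈ W := hW y h.edist_proj_le
  have hle := glueDist_retraction_le hX hemb hmk hF hπ hR h hW rfl
  rwa [hR.eq_self x hxW, hR.eq_self y hyW] at hle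

theorem exists_mem_nhds_glueDist_faceMap_eq (hπ : IsAdjMap π)
    (p : RealToric m F (inducedColoring F lam π)) :
    ∃ U ∈ 𝓝 p, ∀ q ∈ U, ∀ q' ∈ U,
      glueDist (faceMap lam hπ q) (faceMap lam hπ q') = glueDist q q' := by
  obtain ⟨W, hW, R, hR⟩ := hF.exists_isFaceRetraction hX hemb (proj p)
  obtain ⟨ε, hε, hball⟩ := EMetric.mem_nhds_iff.1 hW
  refine ⟨{q | glueDist p q < ε / 3}, ?_, fun q hq q' hq' =>
    (glueDist_faceMap_le hπ q q').antisymm (le_sInf fun l hl => ?_)⟩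
  · refine (continuous_glueDist_left p).continuousAt.eventually_lt_const ?_
    rw [glueDist_self]
    exact ENNReal.div_pos hε.ne' (by norm_num)
  · by_contra! hlt
    refine hlt.not_ge (glueDist_le_of_hasChain_faceMap hX hemb hmk hF hπ hR hl fun u hu => ?_)
    refine hball ?_
    rw [Metric.mem_eball']
    calc edist (proj p).1 u ≤ edist (proj p) (proj q) + edist (proj q).1 u := edist_triangle _ _ _
      _ ≤ glueDist p q + l := add_le_add (edist_proj_le_glueDist p q) hu
      _ < ε / 3 + (ε / 3 + ε / 3) := by
        refine ENNReal.add_lt_add hq (hlt.trans_le ?_)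
        calc glueDist q q' ≤ glueDist p q + glueDist p q' := by
              rw [glueDist_comm p q]; exact glueDist_triangle _ _ _
          _ ≤ ε / 3 + ε / 3 := add_le_add hq.le hq'.le
      _ = ε := by rw [← add_assoc, ENNReal.add_thirds]

end LocalIsometry

end RealToric

end RightAngled

open RightAngled in
theorem mainTheorem9_general {n m k : ℕ} (hmk : m + k = n)
    {P : Type*} [MetricSpace P]
    (hP : IsRightAngledManifold n P) (hemb : EmbeddedFacets n P)
    {V : Type*} [AddCommGroup V] [Module (ZMod 2) V]
    (lam : Facet n P → V) (hlam : IsColoring n P lam)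
    (F : Set P) (hF : IsFace n k F) :
    IsRightAngledManifold m F ∧ EmbeddedFacets m F ∧
    ∃ π : Facet m F → adj n m F,
      (∀ (G : Facet m F) (H : adj n m F), Subtype.val '' G.1 ⊆ H.1.1 ↔ H = π G) ∧
      Function.Surjective π ∧
      IsColoring m F (inducedColoring F lam π) ∧
      ∃ Φ : RealToric m F (inducedColoring F lam π) ≃ₜ
          ((RealToric.proj : RealToric n P lam → P) ⁻¹' F),
        (∀ (v : V) (x : F),
          (Φ (RealToric.mk _ (Submodule.Quotient.mk v) x) : RealToric n P lam) =
            RealToric.mk lam v x) ∧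
        ∀ p, ∃ U ∈ 𝓝 p, ∀ q ∈ U, ∀ q' ∈ U,
          RealToric.glueDist (Φ q : RealToric n P lam) (Φ q' : RealToric n P lam) =
            RealToric.glueDist q q' := by
  obtain ⟨π, hπ⟩ := hF.exists_isAdjMap hP hemb hmk
  exact ⟨hF.isRightAngledManifold hP hemb hmk, hF.embeddedFacets hP hemb hmk, π, hπ,
    hπ.surjective hP hemb hmk hF, hπ.isColoring_inducedColoring hP hemb hmk hF hlam,
    RealToric.faceHomeomorph hP hemb hmk hF lam hπ, fun v x => RealToric.faceMap_mk hπ v x,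
    RealToric.exists_mem_nhds_glueDist_faceMap_eq hP hemb hmk hF hπ⟩

theorem mainTheorem9 {n m k : ℕ} (hmk : m + k = n)
    {P : Type*} [MetricSpace P]
    (hP : RightAngled.IsRightAngledManifold n P) (hemb : RightAngled.EmbeddedFacets n P)
    {V : Type*} [AddCommGroup V] [Module (ZMod 2) V] [Module.Finite (ZMod 2) V]
    (lam : RightAngled.Facet n P → V) (hlam : RightAngled.IsColoring n P lam)
    (F : Set P) (hF : RightAngled.IsFace n k F) :
    -- the face `F` is itself a right-angled hyperbolic manifold with embedded facets
    RightAngled.IsRightAngledManifold m F ∧ RightAngled.EmbeddedFacets m F ∧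
    -- the natural map `Fac(F) → adj(F)`, sending `G` to the only `H ∈ adj(F)` containing it, is
    -- well defined and surjective
    ∃ π : RightAngled.Facet m F → RightAngled.adj n m F,
      (∀ (G : RightAngled.Facet m F) (H : RightAngled.adj n m F),
        Subtype.val '' G.1 ⊆ H.1.1 ↔ H = π G) ∧
      Function.Surjective π ∧
      RightAngled.IsColoring m F (RightAngled.inducedColoring F lam π) ∧
      -- the preimage of `F` in `M(P, lam)` is `M(F, lam_F)`, through `[v̄, x] ↦ [v, x]`, as a
      -- topological space and as a hyperbolic manifold
      ∃ Φ : RightAngled.RealToric m F (RightAngled.inducedColoring F lam π) ≃ₜ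
          ((RightAngled.RealToric.proj : RightAngled.RealToric n P lam → P) ⁻¹' F),
        (∀ (v : V) (x : F),
          (Φ (RightAngled.RealToric.mk _ (Submodule.Quotient.mk v) x) :
              RightAngled.RealToric n P lam) =
            RightAngled.RealToric.mk lam v x) ∧
        ∀ p, ∃ U ∈ 𝓝 p, ∀ q ∈ U, ∀ q' ∈ U,
          RightAngled.RealToric.glueDist (Φ q : RightAngled.RealToric n P lam)
              (Φ q' : RightAngled.RealToric n P lam) =
            RightAngled.RealToric.glueDist q q' :=
  mainTheorem9_general hmk hP hemb lam hlam F hF
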